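/- Let $a<b$ be real numbers and let $r,m\ge 1$ be integers. Write $L_1$ for the complex space $L_1([a,b])$ and $C^{(r-1)}$ for the space of $r-1$ times continuously differentiable functions $[a,b]\to\mathbb C$ with the norm $\sum_{j=0}^{r-1}\max_{[a,b]}|x^{(j)}|$. Write $W_1^r$ for the space of all $x\in C^{(r-1)}$ with $x^{(r-1)}$ absolutely continuous, with the norm $\|x\|_{r,1}=\sum_{j=0}^{r}\int_a^b|x^{(j)}(t)|\,dt$; the norm of $y=(y_1,\dots,y_m)\in(W_1^r)^m$ is $\sum_i\|y_i\|_{r,1}$. Let $A_0,\dots,A_{r-1}\in(L_1)^{m\times m}$, let $B:(C^{(r-1)})^m\to\mathbb C^{rm}$ be an arbitrary continuous linear operator, and suppose that the boundary-value problem $$Ly(t):=y^{(r)}(t)+\sum_{l=1}^{r}A_{r-l}(t)\,y^{(r-l)}(t)=f(t)\ \text{ for a.e. } t\in[a,b],\qquad By=q \tag{1}$$ has a unique solution $y\in(W_1^r)^m$ for all $f\in(L_1)^m$ and $q\in\mathbb C^{rm}$. Let $\mathcal X$ be any dense subset of $(L_1)^{m\times m}$. Then there exists a sequence of multipoint boundary-value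 problems $$L_ky_k(t):=y_k^{(r)}(t)+\sum_{l=1}^{r}A_{r-l,k}(t)\,y_k^{(r-l)}(t)=f(t)\ \text{ for a.e. } t\in[a,b],\qquad B_ky_k:=\sum_{j=1}^{p_k}\sum_{l=0}^{r-1}\beta_k^{j,l}\,y_k^{(l)}(t_{k,j})=q, \tag{2}$$ with $A_{r-l,k}\in\mathcal X$, $p_k\in\mathbb N$, $\beta_k^{j,l}\in\mathbb C^{rm\times m}$ and $t_{k,j}\in[a,b]$ not depending on $f$ and $q$, such that for all sufficiently large $k$ (independently of $f$ and $q$) problem (2) has a unique solution $y_k\in(W_1^r)^m$ for all $f\in(L_1)^m$ and $q\in\mathbb C^{rm}$, and for all $f$ and $q$ $$y_k\to y\quad\text{in }(W_1^r)^m\text{ as }k\to\infty,$$ where $y$ is the solution of (1) with the same $f$ and $q$. Moreover, the sequence can be given explicitly. There are sequences $A_{r-l,k}\in\mathcal X$ with $A_{r-l,k}\to A_{r-l}$ in $(L_1)^{m\times m}$ as $k\to\infty$ for $1\le l\le r$, and for any such sequences the above conclusion holds with the following operators $B_k$, $k=0,1,2,\dots$. Put $N=k+1$ and $t_j=a+j(b-a)/N$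 for $0\le j\le N$, let $h_j$ be the $(r-1)$-fold antiderivative, vanishing at $a$ together with its derivatives of order less than $r-1$, of the hat function $t\mapsto\max\{0,\,1-N|t-t_j|/(b-a)\}$ (for $r=1$, $h_j$ is the hat function itself), and let $e_1,\dots,e_m$ be the standard basis of $\mathbb C^m$. Then $$B_ky=\sum_{l=0}^{r-2}\alpha_l\,y^{(l)}(a)+\sum_{j=0}^{N}\gamma_j\,y^{(r-1)}(t_j),$$ where the $i$-th column of $\alpha_l$ is $B\bigl(\tfrac{(t-a)^l}{l!}\,e_i\bigr)$ and the $i$-th column of $\gamma_j$ is $B(h_j\,e_i)$. -/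

import Mathlib

open MeasureTheory Set Filter Topology
open scoped ENNReal

/-- The underlying complex vector space of `C^{(n)}[a,b]`: all functions `x : [a,b] → ℂ` that are
`n` times continuously differentiable on `[a,b]` (one-sided derivatives at the end points).
`IccExtend` only serves to speak of derivatives; derivatives within `[a,b]` do not see the values
of the extension outside `[a,b]`. -/
def cSubmodule (a b : ℝ) [hab : Fact (a < b)] (n : ℕ) : Submodule ℂ (Icc a b → ℂ) where
  carrier := {x | ContDiffOn ℝ n (IccExtend hab.out.le x) (Icc a b)}
  add_mem' hx hy := ContDiffOn.add hx hy
  zero_mem' := contDiffOn_const (c := (0 : ℂ))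
  smul_mem' c _ hx := ContDiffOn.const_smul c hx

/-- The space `C^{(n)}[a,b]`; its norm is defined below. -/
def CSpace (a b : ℝ) [Fact (a < b)] (n : ℕ) : Type := cSubmodule a b n

namespace CSpace

variable {a b : ℝ} [hab : Fact (a < b)] {n : ℕ}

instance instAddCommGroup : AddCommGroup (CSpace a b n) :=
  inferInstanceAs (AddCommGroup (cSubmodule a b n))

instance instModule : Module ℂ (CSpace a b n) :=
  inferInstanceAs (Module ℂ (cSubmodule a b n))

/-- `x`, as a function on `ℝ` (constant to the left and to the right of `[a,b]`). -/
noncomputable def ext (x : CSpace a b n) : ℝ → ℂ := IccExtend hab.out.le x.1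

theorem contDiffOn_ext (x : CSpace a b n) : ContDiffOn ℝ n x.ext (Icc a b) := x.2

/-- The `j`-th derivative `x^{(j)}` on `[a,b]`. -/
noncomputable def D (j : ℕ) (x : CSpace a b n) : ℝ → ℂ :=
  iteratedDerivWithin j x.ext (Icc a b)

theorem continuousOn_D {j : ℕ} (hj : j ≤ n) (x : CSpace a b n) :
    ContinuousOn (D j x) (Icc a b) :=
  x.contDiffOn_ext.continuousOn_iteratedDerivWithin (by exact_mod_cast hj)
    (uniqueDiffOn_Icc hab.out)

theorem D_add {j : ℕ} (hj : j ≤ n) (x y : CSpace a b n) {t : ℝ} (ht : t ∈ Icc a b) :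
    D j (x + y) t = D j x t + D j y t := by
  have hle : ((j : ℕ) : WithTop ℕ∞) ≤ n := by exact_mod_cast hj
  exact iteratedDerivWithin_add (f := x.ext) (g := y.ext) ht (uniqueDiffOn_Icc hab.out)
    ((x.contDiffOn_ext.of_le hle) t ht) ((y.contDiffOn_ext.of_le hle) t ht)

theorem D_smul {j : ℕ} (hj : j ≤ n) (c : ℂ) (x : CSpace a b n) {t : ℝ} (ht : t ∈ Icc a b) :
    D j (c • x) t = c * D j x t := by
  have hle : ((j : ℕ) : WithTop ℕ∞) ≤ n := by exact_mod_cast hj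
  exact iteratedDerivWithin_const_smul (f := x.ext) ht (uniqueDiffOn_Icc hab.out) c
    ((x.contDiffOn_ext.of_le hle) t ht)

/-- `x ↦ (x, x', …, x^{(n)})`, with values in the `ℓ¹`-sum of `n + 1` copies of `C[a,b]`. -/
noncomputable def jet : CSpace a b n →ₗ[ℂ] PiLp 1 (fun _ : Fin (n + 1) => C(Icc a b, ℂ)) where
  toFun x := WithLp.toLp 1 fun j =>
    ⟨(Icc a b).domRestrict (D j x), (continuousOn_D (by omega) x).domRestrict⟩
  map_add' x y := by
    ext j t
    exact D_add (by omega) x y t.2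
  map_smul' c x := by
    ext j t
    exact D_smul (by omega) c x t.2

theorem jet_injective : Function.Injective (jet : CSpace a b n →ₗ[ℂ] _) := by
  intro x y h
  apply Subtype.ext
  funext t
  have h0 := DFunLike.congr_fun (congrFun (congrArg WithLp.ofLp h) 0) t
  have h1 : D 0 x t = D 0 y t := h0
  simpa [D, ext] using h1

/-- The norm `‖x‖_{(n)} = ∑_{j=0}^{n} max_{[a,b]} |x^{(j)}|`. -/
noncomputable instance instNormedAddCommGroup : NormedAddCommGroup (CSpace a b n) :=
  NormedAddCommGroup.induced _ _ jet jet_injective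

noncomputable instance instNormedSpace : NormedSpace ℂ (CSpace a b n) :=
  NormedSpace.induced ℂ (CSpace a b n) _ jet

/-- The restriction to `[a,b]` of an `n` times continuously differentiable function. -/
def ofContDiff (g : ℝ → ℂ) (hg : ContDiff ℝ n g) : CSpace a b n :=
  ⟨fun t => g t, hg.contDiffOn.congr fun t ht => by simp [IccExtend_of_mem _ _ ht]⟩

end CSpace

/-- `W_1^r[a,b]`, a subset of `C^{(r-1)}[a,b]`: the functions whose derivative of order `r - 1` is
absolutely continuous on `[a,b]`. -/
def sobolevW (a b : ℝ) [Fact (a < b)] (r : ℕ) : Set (CSpace a b (r - 1)) :=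
  {x | AbsolutelyContinuousOnInterval (x.D (r - 1)) a b}

/-- The norm of `(W_1^r)^m`: the sum over the components of `∑_{j=0}^{r} ∫_a^b |x^{(j)}(t)| dt`. -/
noncomputable def sobolevNorm {a b : ℝ} [Fact (a < b)] {r m : ℕ}
    (y : Fin m → CSpace a b (r - 1)) : ℝ≥0∞ :=
  ∑ i, ∑ j ∈ Finset.range (r + 1), ∫⁻ t in Icc a b, ‖(y i).D j t‖ₑ

/-- The complex space `L_1` on `[a,b]`. -/
abbrev L1Space (a b : ℝ) : Type := Lp ℂ 1 (volume.restrict (Icc a b))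

/-- `y ∈ (W_1^r)^m` solves the problem `y^{(r)} + ∑_{l<r} A_l y^{(l)} = f` a.e. on `[a,b]`,
`B y = q`. -/
def IsSolution {a b : ℝ} [Fact (a < b)] {r m : ℕ}
    (A : Fin r → Matrix (Fin m) (Fin m) (L1Space a b))
    (B : (Fin m → CSpace a b (r - 1)) → (Fin (r * m) → ℂ))
    (f : Fin m → L1Space a b) (q : Fin (r * m) → ℂ)
    (y : Fin m → CSpace a b (r - 1)) : Prop :=
  (∀ i, y i ∈ sobolevW a b r) ∧
  (∀ i, ∀ᵐ t ∂(volume.restrict (Icc a b)),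
    (y i).D r t + ∑ l : Fin r, ∑ j : Fin m, A l i j t * (y j).D l t = f i t) ∧
  B y = q

/-- The problem has exactly one solution in `(W_1^r)^m` for all right-hand sides. -/
def UniquelySolvable {a b : ℝ} [Fact (a < b)] {r m : ℕ}
    (A : Fin r → Matrix (Fin m) (Fin m) (L1Space a b))
    (B : (Fin m → CSpace a b (r - 1)) → (Fin (r * m) → ℂ)) : Prop :=
  ∀ (f : Fin m → L1Space a b) (q : Fin (r * m) → ℂ), ∃! y, IsSolution A B f q y

/-- The data of a multipoint boundary operator: `p ≥ 1` points of `[a,b]` and matrices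
`β^{j,l} ∈ ℂ^{rm × m}`. -/
structure MultipointData (a b : ℝ) (r m : ℕ) where
  p : ℕ
  p_pos : 0 < p
  t : Fin p → Icc a b
  β : Fin p → Fin r → Matrix (Fin (r * m)) (Fin m) ℂ

/-- The multipoint boundary operator `y ↦ ∑_j ∑_{l<r} β^{j,l} y^{(l)}(t_j)`. -/
noncomputable def MultipointData.op {a b : ℝ} [Fact (a < b)] {r m : ℕ}
    (M : MultipointData a b r m) (y : Fin m → CSpace a b (r - 1)) : Fin (r * m) → ℂ :=
  ∑ j, ∑ l : Fin r, (M.β j l).mulVec fun i => (y i).D l (M.t j)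

/-- The problems `(A_k, B_k)` approximate the problem `(A, B)`: they are uniquely solvable for all
large `k`, and, whatever the right-hand sides `f` and `q`, their solutions converge in
`(W_1^r)^m` to the solution of the problem `(A, B)` with the same `f` and `q`. -/
def Approximates {a b : ℝ} [Fact (a < b)] {r m : ℕ}
    (Ak : ℕ → Fin r → Matrix (Fin m) (Fin m) (L1Space a b))
    (Bk : ℕ → (Fin m → CSpace a b (r - 1)) → (Fin (r * m) → ℂ))
    (A : Fin r → Matrix (Fin m) (Fin m) (L1Space a b))
    (B : (Fin m → CSpace a b (r - 1)) → (Fin (r * m) → ℂ)) : Prop :=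
  (∀ᶠ k in atTop, UniquelySolvable (Ak k) (Bk k)) ∧
  ∀ (f : Fin m → L1Space a b) (q : Fin (r * m) → ℂ)
    (y : Fin m → CSpace a b (r - 1)) (yk : ℕ → Fin m → CSpace a b (r - 1)),
    IsSolution A B f q y → (∀ᶠ k in atTop, IsSolution (Ak k) (Bk k) f q (yk k)) →
    Tendsto (fun k => sobolevNorm (yk k - y)) atTop (𝓝 0)

/-! ### An explicit multipoint operator -/

/-- The `n`-fold antiderivative of `g` that vanishes at `a` together with its derivatives of
order less than `n`. -/
noncomputable def iterAntideriv (a : ℝ) (g : ℝ → ℂ) : ℕ → ℝ → ℂ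
  | 0 => g
  | n + 1 => fun t => ∫ s in a..t, iterAntideriv a g n s

theorem contDiff_iterAntideriv (a : ℝ) {g : ℝ → ℂ} (hg : Continuous g) (n : ℕ) :
    ContDiff ℝ n (iterAntideriv a g n) := by
  induction n with
  | zero => exact_mod_cast contDiff_zero.2 hg
  | succ n ih =>
    have hd : ∀ t, HasDerivAt (iterAntideriv a g (n + 1)) (iterAntideriv a g n t) t := fun t =>
      intervalIntegral.integral_hasDerivAt_right (ih.continuous.intervalIntegrable _ _)
        (ih.continuous.stronglyMeasurableAtFilter _ _) ih.continuous.continuousAt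
    have h2 : deriv (iterAntideriv a g (n + 1)) = iterAntideriv a g n :=
      funext fun t => (hd t).deriv
    have h1 : ContDiff ℝ ((n : WithTop ℕ∞) + 1) (iterAntideriv a g (n + 1)) := by
      rw [contDiff_succ_iff_deriv]
      refine ⟨fun t => (hd t).differentiableAt, by simp, ?_⟩
      rw [h2]
      exact ih
    exact_mod_cast h1

/-- The nodes `a + j (b - a) / N`. -/
noncomputable def node (a b : ℝ) (N j : ℕ) : ℝ := a + j * (b - a) / N

/-- The continuous, piecewise linear function that equals `1` at the `j`-th node and `0` at the
other nodes. -/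
noncomputable def hat (a b : ℝ) (N j : ℕ) (t : ℝ) : ℂ :=
  ((max 0 (1 - |t - node a b N j| * N / (b - a)) : ℝ) : ℂ)

theorem continuous_hat (a b : ℝ) (N j : ℕ) : Continuous (hat a b N j) := by
  unfold hat
  fun_prop

theorem node_mem (a b : ℝ) [hab : Fact (a < b)] {N j : ℕ} (hN : 0 < N) (hj : j ≤ N) :
    node a b N j ∈ Icc a b := by
  have h0 : 0 < b - a := sub_pos.2 hab.out
  have hN' : (0 : ℝ) < N := by exact_mod_cast hN
  have hj' : (j : ℝ) ≤ N := by exact_mod_cast hj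
  refine ⟨?_, ?_⟩
  · have : 0 ≤ (j : ℝ) * (b - a) / N := by positivity
    unfold node
    linarith
  · have : (j : ℝ) * (b - a) / N ≤ b - a := by
      rw [div_le_iff₀ hN']
      nlinarith
    unfold node
    linarith

/-- The function `(t - a)^l / l!`, an element of `C^{(n)}[a,b]`. -/
noncomputable def taylorMonomial (a b : ℝ) [Fact (a < b)] (n l : ℕ) : CSpace a b n :=
  CSpace.ofContDiff (fun t => (((t - a) ^ l / l.factorial : ℝ) : ℂ))
    (Complex.ofRealCLM.contDiff.comp
      (((contDiff_id.sub contDiff_const).pow l).div_const (l.factorial : ℝ)))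

/-- The `n`-fold antiderivative of the `j`-th hat function, an element of `C^{(n)}[a,b]`. -/
noncomputable def hatAntideriv (a b : ℝ) [Fact (a < b)] (n N j : ℕ) : CSpace a b n :=
  CSpace.ofContDiff (iterAntideriv a (hat a b N j) n)
    (contDiff_iterAntideriv a (continuous_hat a b N j) n)

/-- The explicit multipoint operator built from `B` on the `N + 1` equidistant nodes
`t_0 = a, …, t_N = b`, where `N = k + 1`:
`B_k y = ∑_{l<r-1} α_l y^{(l)}(a) + ∑_{j=0}^{N} γ_j y^{(r-1)}(t_j)`. The `i`-th column of `α_l` is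
the value of `B` at `e_i (t-a)^l / l!`; that of `γ_j` is the value of `B` at `e_i h_j`, where `h_j`
is the `(r-1)`-fold antiderivative of the `j`-th hat function and `e_i` the `i`-th unit vector. -/
noncomputable def explicitMultipoint {a b : ℝ} [Fact (a < b)] {r m : ℕ}
    (B : (Fin m → CSpace a b (r - 1)) → (Fin (r * m) → ℂ)) (k : ℕ) : MultipointData a b r m where
  p := k + 2
  p_pos := by omega
  t j := ⟨node a b (k + 1) j, node_mem a b (by omega) (by omega)⟩
  β j l := Matrix.of fun s i =>
    if (l : ℕ) = r - 1 then B (Pi.single i (hatAntideriv a b (r - 1) (k + 1) j)) s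
    else if (j : ℕ) = 0 then B (Pi.single i (taylorMonomial a b (r - 1) l)) s
    else 0

/-! A function in `(W_1^r)^m` is encoded by its Taylor coefficients at `a` below order `r` and its
`r`-th derivative in `L_1`. This makes the problem an operator `P = (L, B)` from a Banach space to
`(L_1)^m × ℂ^{rm}`, and unique solvability means that `P` is bijective (`uniquelySolvable_iff`).

The two components of `P_k` converge in different senses. Multiplication `L_1 × C → L_1` is bounded
bilinear, so `L_k → L` in operator norm (`tendsto_diffL`). For the boundary part, `B_k y = B (I_k
y)` (`explicitMultipoint_op`), where `I_k` keeps the Taylor data at `a` of order below `r - 1` and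
replaces `y^{(r-1)}` by its piecewise linear interpolant. Uniform continuity gives `I_k y → y` in
`C^{(r-1)}` (`CSpace.tendsto_interp`), hence `B_k → B` pointwise.

Pointwise convergence alone does not preserve invertibility; it suffices here because the boundary
values lie in a finite-dimensional space (`eventually_bijective_of_tendsto_id`). Put `Q_k = P_k
P⁻¹`. Every block of `Q_k - 1` tends to zero in norm, except possibly the block `N_k : (L_1)^m →
ℂ^{rm}`, which is uniformly bounded and tends to zero pointwise. Since `N_k² = 0`, the factor `1 -
N_k` is invertible, and `Q_k (1 - N_k) → 1` in norm. Thus `Q_k` is eventually bijective and its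
inverses converge pointwise to the identity. -/

section AbstractConvergence

/-! ### Invertibility under mixed norm and pointwise convergence -/

theorem ContinuousLinearMap.tendsto_comp {α E F G : Type*} [NormedAddCommGroup E]
    [NormedSpace ℂ E] [NormedAddCommGroup F] [NormedSpace ℂ F] [NormedAddCommGroup G]
    [NormedSpace ℂ G] {l : Filter α} {f : α → F →L[ℂ] G} {g : α → E →L[ℂ] F} {f₀ : F →L[ℂ] G}
    {g₀ : E →L[ℂ] F} (hf : Tendsto f l (𝓝 f₀)) (hg : Tendsto g l (𝓝 g₀)) :
    Tendsto (fun k => (f k).comp (g k)) l (𝓝 (f₀.comp g₀)) :=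
  ((isBoundedBilinearMap_comp (𝕜 := ℂ)).continuous.tendsto (f₀, g₀)).comp (hf.prodMk_nhds hg)

/-- An operator on `ℂ^ι` is a finite sum of coordinate functionals times its values on the basis
vectors, so convergence on the basis already controls the norm. -/
theorem ContinuousLinearMap.tendsto_zero_of_pi {ι G : Type*} [Fintype ι] [DecidableEq ι]
    [NormedAddCommGroup G] [NormedSpace ℂ G] {T : ℕ → (ι → ℂ) →L[ℂ] G}
    (h : ∀ z, Tendsto (fun k => T k z) atTop (𝓝 0)) : Tendsto T atTop (𝓝 0) := by
  have hrep : ∀ k, ∑ i, (ContinuousLinearMap.proj (R := ℂ) (φ := fun _ : ι => ℂ) i).smulRight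
      (T k (Pi.single i 1)) = T k := by
    intro k
    refine ContinuousLinearMap.ext fun z => ?_
    conv_rhs => rw [← Finset.univ_sum_single z, map_sum]
    rw [_root_.sum_apply]
    refine Finset.sum_congr rfl fun i _ => ?_
    rw [ContinuousLinearMap.smulRight_apply, ← map_smul, ← Pi.single_smul]
    simp
  have h1 : Tendsto (fun k => ∑ i,
      (ContinuousLinearMap.proj (R := ℂ) (φ := fun _ : ι => ℂ) i).smulRight
        (T k (Pi.single i 1))) atTop (𝓝 (∑ i : ι, 0)) := by
    refine tendsto_finsetSum _ fun i _ => ?_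
    have h2 := ((ContinuousLinearMap.smulRightL ℂ (ι → ℂ) G
      (ContinuousLinearMap.proj (R := ℂ) (φ := fun _ : ι => ℂ) i)).continuous.tendsto 0).comp
        (h (Pi.single i 1))
    rwa [map_zero] at h2
  simpa [hrep] using h1

variable {ι E F : Type*} [Fintype ι] [NormedAddCommGroup E] [NormedSpace ℂ E] [CompleteSpace E]
  [NormedAddCommGroup F] [NormedSpace ℂ F] [CompleteSpace F]

/-- Operators on a product with a finite-dimensional factor that converge to the identity, in norm
in the first component and pointwise in the second, are eventually bijective, and their inverses
converge pointwise to the identity. -/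
theorem eventually_bijective_of_tendsto_id {Q : ℕ → (F × (ι → ℂ)) →L[ℂ] (F × (ι → ℂ))}
    (h1 : Tendsto (fun k => (ContinuousLinearMap.fst ℂ F (ι → ℂ)).comp (Q k)) atTop
      (𝓝 (ContinuousLinearMap.fst ℂ F (ι → ℂ))))
    (h2 : ∀ z, Tendsto (fun k => (Q k z).2) atTop (𝓝 z.2)) :
    (∀ᶠ k in atTop, Function.Bijective (Q k)) ∧
    ∀ z (w : ℕ → F × (ι → ℂ)), (∀ᶠ k in atTop, Q k (w k) = z) → Tendsto w atTop (𝓝 z) := by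
  classical
  set fst' := ContinuousLinearMap.fst ℂ F (ι → ℂ)
  set snd' := ContinuousLinearMap.snd ℂ F (ι → ℂ)
  set inl' := ContinuousLinearMap.inl ℂ F (ι → ℂ)
  set inr' := ContinuousLinearMap.inr ℂ F (ι → ℂ)
  -- The block of `Q k` from `F` to `ℂ^ι`: the only one whose convergence is merely pointwise.
  set N : ℕ → (F × (ι → ℂ)) →L[ℂ] (F × (ι → ℂ)) := fun k =>
    inr'.comp ((snd'.comp (Q k)).comp (inl'.comp fst'))
  have hNapp : ∀ k z, N k z = (0, (Q k (z.1, 0)).2) := fun k z => rfl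
  have hN2 : ∀ k, N k * N k = 0 := by
    intro k
    ext z <;> simp [hNapp, ContinuousLinearMap.mul_def] <;> exact (congrArg Prod.snd (map_zero (Q k)) ▸ rfl)
  have hN0 : ∀ z, Tendsto (fun k => N k z) atTop (𝓝 0) := by
    intro z
    simp only [hNapp]
    exact (tendsto_const_nhds (x := (0 : F))).prodMk_nhds (h2 (z.1, 0))
  obtain ⟨C, hC⟩ : ∃ C, ∀ k, ‖N k‖ ≤ C := by
    refine banach_steinhaus fun z => ?_
    obtain ⟨C, hC⟩ := (hN0 z).norm.bddAbove_range
    exact ⟨C, fun k => hC ⟨k, rfl⟩⟩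
  -- The deviation of the `ℂ^ι`-block from the identity; its domain is finite-dimensional, so it
  -- tends to zero in norm.
  set D : ℕ → (ι → ℂ) →L[ℂ] (ι → ℂ) := fun k =>
    (snd'.comp (Q k)).comp inr' - ContinuousLinearMap.id ℂ _
  have hDapp : ∀ k z, D k z = (Q k (0, z)).2 - z := fun k z => rfl
  have hD0 : Tendsto D atTop (𝓝 0) := by
    refine ContinuousLinearMap.tendsto_zero_of_pi fun z => ?_
    simp only [hDapp]
    simpa using (h2 (0, z)).sub_const z
  -- Write `Q = 1 + N + S`, where `S` collects the blocks that vanish in norm. As `N² = 0`, this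
  -- gives `Q (1 - N) = 1 + S (1 - N)`, and `‖1 - N‖ ≤ 1 + C`.
  have hR : Tendsto (fun k => Q k * (1 - N k)) atTop (𝓝 1) := by
    have hS : Tendsto (fun k => inl'.comp (fst'.comp (Q k) - fst') +
        inr'.comp ((D k).comp snd')) atTop (𝓝 0) := by
      have e1 := ContinuousLinearMap.tendsto_comp (tendsto_const_nhds (x := inl'))
        (h1.sub_const fst')
      have e2 := ContinuousLinearMap.tendsto_comp (tendsto_const_nhds (x := inr'))
        (ContinuousLinearMap.tendsto_comp hD0 (tendsto_const_nhds (x := snd')))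
      simpa using e1.add e2
    have heq : ∀ k, Q k * (1 - N k) - 1 = (inl'.comp (fst'.comp (Q k) - fst') +
        inr'.comp ((D k).comp snd')) * (1 - N k) := by
      intro k
      refine ContinuousLinearMap.ext fun z => ?_
      have hz : ∀ g : ι → ℂ, Q k (z.1, g) = Q k (z.1, 0) + Q k (0, g) := by
        intro g; rw [← map_add]; simp
      have hz' : ∀ g g' : ι → ℂ, Q k (0, g - g') = Q k (0, g) - Q k (0, g') := by
        intro g g'; rw [← map_sub]; simp
      have hz1 : z - N k z = (z.1, z.2 - (Q k (z.1, 0)).2) := by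
        rw [hNapp]; ext <;> simp
      have hl : (Q k * (1 - N k) - 1) z = Q k (z - N k z) - z := rfl
      have hr : ((inl'.comp (fst'.comp (Q k) - fst') +
        inr'.comp ((D k).comp snd')) * (1 - N k)) z =
          ((Q k (z - N k z)).1 - (z - N k z).1, 0) + (0, D k (z - N k z).2) := rfl
      rw [hl, hr, hDapp, hz1]
      ext1
      · simp
      · simp only [Prod.snd_sub, Prod.snd_add, zero_add]
        rw [hz, hz']
        simp only [Prod.snd_sub, Prod.snd_add]
        abel
    rw [tendsto_iff_norm_sub_tendsto_zero]
    have hS' := (tendsto_norm_zero.comp hS).mul_const (1 + C)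
    rw [zero_mul] at hS'
    refine squeeze_zero (fun _ => norm_nonneg _) (fun k => ?_) hS'
    rw [heq]
    refine (norm_mul_le _ _).trans ?_
    refine mul_le_mul_of_nonneg_left ?_ (norm_nonneg _)
    refine (norm_sub_le _ _).trans (add_le_add ?_ (hC k))
    exact ContinuousLinearMap.norm_id_le
  have hunit : ∀ᶠ k in atTop, IsUnit (Q k * (1 - N k)) :=
    hR.eventually (Units.isOpen.mem_nhds isUnit_one)
  have hNu : ∀ k, IsUnit (1 - N k) := fun k =>
    ⟨⟨1 - N k, 1 + N k, by simp [sub_mul, mul_add, hN2], by simp [mul_sub, add_mul, hN2]⟩, rfl⟩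
  have hbij : ∀ᶠ k in atTop, Function.Bijective (Q k) := by
    filter_upwards [hunit] with k hk
    have h3 := (ContinuousLinearMap.isUnit_iff_bijective.1 hk)
    have h4 := (ContinuousLinearMap.isUnit_iff_bijective.1 (hNu k))
    change Function.Bijective (Q k ∘ (1 - N k : (F × (ι → ℂ)) →L[ℂ] (F × (ι → ℂ)))) at h3
    exact (Function.Bijective.of_comp_iff _ h4).1 h3
  refine ⟨hbij, fun z w hw => ?_⟩
  have hinv : Tendsto (fun k => Ring.inverse (Q k * (1 - N k)) z) atTop (𝓝 z) := by
    have h3 := (NormedRing.inverse_continuousAt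
      (1 : ((F × (ι → ℂ)) →L[ℂ] (F × (ι → ℂ)))ˣ)).tendsto.comp hR
    rw [Units.val_one, Ring.inverse_one] at h3
    exact ((ContinuousLinearMap.apply ℂ _ z).continuous.tendsto _).comp h3
  -- Eventually `(1 - N k) (v k)` is the solution of `Q k w = z`.
  set v := fun k => Ring.inverse (Q k * (1 - N k)) z
  have hNv : Tendsto (fun k => N k (v k)) atTop (𝓝 0) := by
    have h3 : Tendsto (fun k => N k (v k - z)) atTop (𝓝 0) := by
      rw [tendsto_zero_iff_norm_tendsto_zero]
      have h4 := (tendsto_iff_norm_sub_tendsto_zero.1 hinv).const_mul C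
      refine squeeze_zero (fun _ => norm_nonneg _) (fun k => ?_) (by simpa using h4)
      exact ContinuousLinearMap.le_of_opNorm_le _ (hC k) _
    simpa using h3.add (hN0 z)
  have hlim : Tendsto (fun k => v k - N k (v k)) atTop (𝓝 z) := by simpa using hinv.sub hNv
  refine hlim.congr' ?_
  filter_upwards [hunit, hbij, hw] with k hk hb hwk
  apply hb.1
  rw [hwk]
  have := congrArg (fun T : (F × (ι → ℂ)) →L[ℂ] (F × (ι → ℂ)) => T z)
    (Ring.mul_inverse_cancel _ hk)
  exact this

/-- Suppose `P` is a bijection onto `F × ℂ^ι`. If the first components of `P k` converge in norm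
and the second ones pointwise to those of `P`, then the `P k` are eventually bijective, and
solutions of `P k x = z` converge to the solution of `P x = z`. -/
theorem eventually_bijective_of_tendsto {P : E →L[ℂ] (F × (ι → ℂ))} (hP : Function.Bijective P)
    {Pk : ℕ → E →L[ℂ] (F × (ι → ℂ))}
    (h1 : Tendsto (fun k => (ContinuousLinearMap.fst ℂ F (ι → ℂ)).comp (Pk k)) atTop
      (𝓝 ((ContinuousLinearMap.fst ℂ F (ι → ℂ)).comp P)))
    (h2 : ∀ x, Tendsto (fun k => (Pk k x).2) atTop (𝓝 (P x).2)) :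
    (∀ᶠ k in atTop, Function.Bijective (Pk k)) ∧
    ∀ z x (w : ℕ → E), P x = z → (∀ᶠ k in atTop, Pk k (w k) = z) → Tendsto w atTop (𝓝 x) := by
  -- The open mapping theorem makes `P⁻¹` continuous, which reduces the claim to `Q k = Pk k ∘ P⁻¹`.
  set e := ContinuousLinearEquiv.ofBijective P (LinearMap.ker_eq_bot.2 hP.1)
    (LinearMap.range_eq_top.2 hP.2)
  have he : ∀ x, e x = P x := fun x => rfl
  have heq : P.comp (e.symm : (F × (ι → ℂ)) →L[ℂ] E) = ContinuousLinearMap.id ℂ _ :=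
    ContinuousLinearMap.ext fun z => (he _).symm.trans (e.apply_symm_apply z)
  obtain ⟨hb, hc⟩ := eventually_bijective_of_tendsto_id
    (Q := fun k => (Pk k).comp (e.symm : (F × (ι → ℂ)) →L[ℂ] E))
    (by
      have := ContinuousLinearMap.tendsto_comp h1
        (tendsto_const_nhds (x := (e.symm : (F × (ι → ℂ)) →L[ℂ] E)))
      rw [ContinuousLinearMap.comp_assoc, heq, ContinuousLinearMap.comp_id] at this
      exact this)
    (by
      intro z
      have := h2 (e.symm z)
      rw [← he, e.apply_symm_apply] at this
      exact this)
  refine ⟨?_, fun z x w hx hw => ?_⟩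
  · filter_upwards [hb] with k hk
    exact (Function.Bijective.of_comp_iff (Pk k) e.symm.bijective).1 hk
  · have h3 := hc z (fun k => e (w k)) (by filter_upwards [hw] with k hk; simpa using hk)
    have h4 := (e.symm.continuous.tendsto z).comp h3
    have h5 : e.symm z = x := by rw [← hx, ← he, e.symm_apply_apply]
    rw [h5] at h4
    simpa [Function.comp_def] using h4

end AbstractConvergence

/-! ### Derivatives of iterated antiderivatives and Taylor monomials -/

section IteratedAntiderivative

theorem hasDerivAt_iterAntideriv (a : ℝ) {g : ℝ → ℂ} (hg : Continuous g) (n : ℕ) (t : ℝ) :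
    HasDerivAt (iterAntideriv a g (n + 1)) (iterAntideriv a g n t) t :=
  have h := (contDiff_iterAntideriv a hg n).continuous
  intervalIntegral.integral_hasDerivAt_right (h.intervalIntegrable _ _)
    (h.stronglyMeasurableAtFilter _ _) h.continuousAt

theorem iteratedDeriv_iterAntideriv (a : ℝ) {g : ℝ → ℂ} (hg : Continuous g) (j k : ℕ) :
    iteratedDeriv j (iterAntideriv a g (k + j)) = iterAntideriv a g k := by
  induction j generalizing k with
  | zero => simp
  | succ j ih =>
    rw [iteratedDeriv_succ', ← add_assoc, ← ih k]
    congr 1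
    funext t
    exact (hasDerivAt_iterAntideriv a hg _ t).deriv

theorem iterAntideriv_succ_self (a : ℝ) (g : ℝ → ℂ) (k : ℕ) : iterAntideriv a g (k + 1) a = 0 :=
  intervalIntegral.integral_same

theorem hasDerivAt_sub_pow_div_factorial (a t : ℝ) (l : ℕ) :
    HasDerivAt (fun t : ℝ => (((t - a) ^ (l + 1) / (l + 1).factorial : ℝ) : ℂ))
      (((t - a) ^ l / l.factorial : ℝ) : ℂ) t := by
  have h := ((((hasDerivAt_id t).sub_const a).pow (l + 1)).div_const
    ((l + 1).factorial : ℝ)).ofReal_comp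
  refine h.congr_deriv ?_
  congr 1
  have h1 : (l.factorial : ℝ) ≠ 0 := by positivity
  simp only [id, Nat.factorial_succ, Nat.cast_mul, Nat.cast_add, Nat.cast_one, mul_one,
    Nat.add_sub_cancel]
  field_simp

theorem iteratedDeriv_sub_pow_div_factorial (a : ℝ) (j k : ℕ) :
    iteratedDeriv j (fun t : ℝ => (((t - a) ^ (k + j) / (k + j).factorial : ℝ) : ℂ)) =
      fun t => (((t - a) ^ k / k.factorial : ℝ) : ℂ) := by
  induction j generalizing k with
  | zero => simp
  | succ j ih =>
    rw [iteratedDeriv_succ', ← ih k]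
    congr 1
    funext t
    exact (hasDerivAt_sub_pow_div_factorial a t (k + j)).deriv

theorem iteratedDeriv_sub_pow_div_factorial_of_lt (a : ℝ) {j l : ℕ} (h : l < j) :
    iteratedDeriv j (fun t : ℝ => (((t - a) ^ l / l.factorial : ℝ) : ℂ)) = 0 := by
  induction l generalizing j with
  | zero =>
    obtain ⟨i, rfl⟩ := Nat.exists_eq_add_of_lt h
    funext t
    simp [iteratedDeriv_const]
  | succ l ih =>
    obtain ⟨i, rfl⟩ : ∃ i, j = i + 1 := ⟨j - 1, by omega⟩
    rw [iteratedDeriv_succ', ← ih (j := i) (by omega)]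
    congr 1
    funext t
    exact (hasDerivAt_sub_pow_div_factorial a t l).deriv

end IteratedAntiderivative

/-! ### Taylor data and norm estimates in `C^{(n)}` -/

namespace CSpace

variable {a b : ℝ} [hab : Fact (a < b)] {n : ℕ}

theorem left_mem : a ∈ Icc a b := left_mem_Icc.2 hab.out.le

/-- The `j`-th derivative as a continuous linear operator into `C[a,b]`. -/
noncomputable def derivL (j : ℕ) (hj : j ≤ n) : CSpace a b n →L[ℂ] C(Icc a b, ℂ) :=
  (PiLp.proj 1 (fun _ : Fin (n + 1) => C(Icc a b, ℂ)) (⟨j, by omega⟩ : Fin (n + 1)) :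
    _ →L[ℂ] C(Icc a b, ℂ)).comp
    -- The norm is induced by `jet`, which is therefore an isometry by definition.
    (⟨jet, fun _ => rfl⟩ : CSpace a b n →ₗᵢ[ℂ] _).toContinuousLinearMap

theorem derivL_apply {j : ℕ} (hj : j ≤ n) (x : CSpace a b n) (t : Icc a b) :
    derivL j hj x t = x.D j t := rfl

theorem norm_eq_sum (x : CSpace a b n) :
    ‖x‖ = ∑ j : Fin (n + 1), ‖derivL (j : ℕ) (by omega) x‖ := by
  change ‖jet x‖ = _
  rw [PiLp.norm_eq_of_L1]
  rfl

theorem norm_derivL_le {j : ℕ} (hj : j ≤ n) (x : CSpace a b n) : ‖derivL j hj x‖ ≤ ‖x‖ := by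
  exact PiLp.norm_apply_le (jet x) ⟨j, by omega⟩

theorem norm_D_le {j : ℕ} (hj : j ≤ n) (x : CSpace a b n) {t : ℝ} (ht : t ∈ Icc a b) :
    ‖x.D j t‖ ≤ ‖x‖ :=
  ((derivL j hj x).norm_coe_le_norm ⟨t, ht⟩).trans (norm_derivL_le hj x)

theorem D_sub {j : ℕ} (hj : j ≤ n) (x y : CSpace a b n) {t : ℝ} (ht : t ∈ Icc a b) :
    (x - y).D j t = x.D j t - y.D j t :=
  congrArg (fun f : C(Icc a b, ℂ) => f ⟨t, ht⟩) (map_sub (derivL j hj) x y)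

theorem D_sum {ι : Type*} (s : Finset ι) {j : ℕ} (hj : j ≤ n) (x : ι → CSpace a b n) {t : ℝ}
    (ht : t ∈ Icc a b) : (∑ i ∈ s, x i).D j t = ∑ i ∈ s, (x i).D j t := by
  have h := congrArg (fun f : C(Icc a b, ℂ) => f ⟨t, ht⟩) (map_sum (derivL j hj) x s)
  exact h.trans (ContinuousMap.sum_apply _ _ _)

theorem D_ofContDiff {j : ℕ} (hj : j ≤ n) (g : ℝ → ℂ) (hg : ContDiff ℝ n g) {t : ℝ}
    (ht : t ∈ Icc a b) : (ofContDiff g hg : CSpace a b n).D j t = iteratedDeriv j g t := by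
  have h : EqOn (ofContDiff g hg : CSpace a b n).ext g (Icc a b) := fun s hs => by
    simp [ext, ofContDiff, IccExtend_of_mem _ _ hs]
  rw [D, iteratedDerivWithin_congr h ht]
  exact iteratedDerivWithin_eq_iteratedDeriv (uniqueDiffOn_Icc hab.out)
    ((hg.of_le (by exact_mod_cast hj)).contDiffAt) ht

theorem D_taylorMonomial {j l : ℕ} (hj : j ≤ n) {t : ℝ}
    (ht : t ∈ Icc a b) : (taylorMonomial a b n l).D j t =
      if j ≤ l then (((t - a) ^ (l - j) / (l - j).factorial : ℝ) : ℂ) else 0 := by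
  refine (D_ofContDiff hj (fun t : ℝ => (((t - a) ^ l / l.factorial : ℝ) : ℂ)) _ ht).trans ?_
  split_ifs with h
  · obtain ⟨k, rfl⟩ := Nat.exists_eq_add_of_le' h
    rw [iteratedDeriv_sub_pow_div_factorial, Nat.add_sub_cancel]
  · rw [iteratedDeriv_sub_pow_div_factorial_of_lt a (by omega)]
    rfl

theorem differentiableOn_D {j : ℕ} (hj : j < n) (x : CSpace a b n) :
    DifferentiableOn ℝ (x.D j) (Icc a b) :=
  x.contDiffOn_ext.differentiableOn_iteratedDerivWithin (by exact_mod_cast hj)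
    (uniqueDiffOn_Icc hab.out)

/-- A function whose derivatives of order less than `n` vanish at `a` is controlled by its
derivative of order `n`. -/
theorem norm_D_le_of_vanishing (x : CSpace a b n) (h0 : ∀ l < n, x.D l a = 0) {ε : ℝ}
    (hε : ∀ t ∈ Icc a b, ‖x.D n t‖ ≤ ε) {j k : ℕ} (hjk : j + k = n) {t : ℝ}
    (ht : t ∈ Icc a b) : ‖x.D j t‖ ≤ ε * (b - a) ^ k := by
  have hε0 : 0 ≤ ε := (norm_nonneg _).trans (hε a left_mem)
  have hba : 0 ≤ b - a := sub_nonneg.2 hab.out.le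
  induction k generalizing j t with
  | zero => obtain rfl : j = n := by omega
            simpa using hε t ht
  | succ k ih =>
    -- Mean value inequality from `a`: each step down in the order of the derivative costs a factor
    -- `b - a`.
    have h := norm_image_sub_le_of_norm_deriv_le_segment (C := ε * (b - a) ^ k)
      (x.differentiableOn_D (show j < n by omega)) (fun s hs => by
        have := ih (j := j + 1) (by omega) (Ico_subset_Icc_self hs)
        rwa [D, iteratedDerivWithin_succ] at this) t ht
    rw [h0 j (by omega), sub_zero] at h
    refine h.trans ?_
    rw [pow_succ, ← mul_assoc]
    exact mul_le_mul_of_nonneg_left (by linarith [ht.2]) (by positivity)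

theorem norm_le_of_vanishing (x : CSpace a b n) (h0 : ∀ l < n, x.D l a = 0) {ε : ℝ}
    (hε : ∀ t ∈ Icc a b, ‖x.D n t‖ ≤ ε) :
    ‖x‖ ≤ ε * ∑ j : Fin (n + 1), (b - a) ^ (n - j) := by
  have hε0 : 0 ≤ ε := (norm_nonneg _).trans (hε a left_mem)
  have hba : 0 ≤ b - a := sub_nonneg.2 hab.out.le
  rw [norm_eq_sum, Finset.mul_sum]
  refine Finset.sum_le_sum fun j _ => ?_
  rw [ContinuousMap.norm_le _ (by positivity)]
  exact fun t => x.norm_D_le_of_vanishing h0 hε (j := j) (k := n - j) (by omega) t.2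

theorem eq_of_D_eq {x y : CSpace a b n} (h0 : ∀ l < n, x.D l a = y.D l a)
    (hn : ∀ t ∈ Icc a b, x.D n t = y.D n t) : x = y := by
  have h := norm_le_of_vanishing (x - y) (ε := 0)
    (fun l hl => by rw [D_sub hl.le _ _ left_mem, h0 l hl, sub_self])
    (fun t ht => by rw [D_sub le_rfl _ _ ht, hn t ht, sub_self, norm_zero])
  rw [zero_mul] at h
  exact sub_eq_zero.1 (norm_le_zero_iff.1 h)

/-- The function with prescribed derivatives at `a` up to order `n - 1` and prescribed derivative
of order `n`. -/
theorem exists_D_eq (c : ℕ → ℂ) {g : ℝ → ℂ} (hg : ContinuousOn g (Icc a b)) :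
    ∃ x : CSpace a b n, (∀ l < n, x.D l a = c l) ∧ ∀ t ∈ Icc a b, x.D n t = g t := by
  have hg' : Continuous (IccExtend hab.out.le ((Icc a b).domRestrict g)) :=
    hg.domRestrict.Icc_extend'
  -- The Taylor polynomial has degree below `n` and does not affect the `n`-th derivative; the
  -- antiderivative does not affect the lower derivatives at `a`.
  refine ⟨∑ l ∈ Finset.range n, c l • taylorMonomial a b n l +
    ofContDiff _ (contDiff_iterAntideriv a hg' n), fun l hl => ?_, fun t ht => ?_⟩
  · rw [D_add hl.le _ _ left_mem, D_sum _ hl.le _ left_mem, D_ofContDiff hl.le _ _ left_mem]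
    obtain ⟨k, rfl⟩ := Nat.exists_eq_add_of_lt hl
    rw [show l + k + 1 = k + 1 + l by omega, iteratedDeriv_iterAntideriv a hg',
      iterAntideriv_succ_self, add_zero, Finset.sum_eq_single_of_mem l (by simp)]
    · rw [D_smul (by omega) _ _ left_mem, D_taylorMonomial (by omega) left_mem]
      simp
    · intro i _ hil
      rw [D_smul (by omega) _ _ left_mem, D_taylorMonomial (by omega) left_mem]
      split_ifs with h
      · rw [sub_self, zero_pow (by omega)]; simp
      · simp
  · rw [D_add le_rfl _ _ ht, D_sum _ le_rfl _ ht, D_ofContDiff le_rfl _ _ ht]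
    have h1 := iteratedDeriv_iterAntideriv a hg' n 0
    rw [zero_add] at h1
    rw [h1, Finset.sum_eq_zero, zero_add]
    · simp [iterAntideriv, IccExtend_of_mem _ _ ht]
    · intro i hi
      rw [D_smul le_rfl _ _ ht, D_taylorMonomial le_rfl ht, if_neg, mul_zero]
      simpa using hi

end CSpace

/-! ### Complex-valued absolutely continuous functions -/

section AbsolutelyContinuous

theorem LipschitzWith.comp_absolutelyContinuousOnInterval {X Y : Type*} [PseudoMetricSpace X]
    [PseudoMetricSpace Y] {K : NNReal} {φ : X → Y} (hφ : LipschitzWith K φ) {f : ℝ → X} {a b : ℝ}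
    (hf : AbsolutelyContinuousOnInterval f a b) :
    AbsolutelyContinuousOnInterval (fun t => φ (f t)) a b := by
  have h := Tendsto.const_mul (K : ℝ) hf
  rw [mul_zero] at h
  refine squeeze_zero (fun E => Finset.sum_nonneg fun _ _ => dist_nonneg) (fun E => ?_) h
  rw [Finset.mul_sum]
  exact Finset.sum_le_sum fun i _ => hφ.dist_le_mul _ _

theorem AbsolutelyContinuousOnInterval.congr {X : Type*} [PseudoMetricSpace X] {f g : ℝ → X}
    {a b : ℝ} (hf : AbsolutelyContinuousOnInterval f a b) (h : EqOn f g (uIcc a b)) :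
    AbsolutelyContinuousOnInterval g a b := by
  refine Tendsto.congr' ?_ hf
  filter_upwards [mem_inf_of_right (mem_principal_self _)] with E hE
  exact Finset.sum_congr rfl fun i hi => by rw [h (hE.1 i hi).1, h (hE.1 i hi).2]

theorem absolutelyContinuousOnInterval_of_re_im {f : ℝ → ℂ} {a b : ℝ}
    (hre : AbsolutelyContinuousOnInterval (fun t => (f t).re) a b)
    (him : AbsolutelyContinuousOnInterval (fun t => (f t).im) a b) :
    AbsolutelyContinuousOnInterval f a b := by
  have h1 := Complex.isometry_ofReal.lipschitz.comp_absolutelyContinuousOnInterval hre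
  have h2 := (Complex.isometry_ofReal.lipschitz.comp_absolutelyContinuousOnInterval him).const_smul
    Complex.I
  have h := h1.add h2
  refine h.congr fun t _ => ?_
  simp [mul_comm Complex.I]

theorem absolutelyContinuousOnInterval_primitive {u : ℝ → ℂ} {a b : ℝ}
    (hu : IntervalIntegrable u volume a b) (c : ℂ) :
    AbsolutelyContinuousOnInterval (fun t => c + ∫ s in a..t, u s) a b := by
  have hc : AbsolutelyContinuousOnInterval (fun _ : ℝ => c) a b :=
    (LipschitzWith.const c).lipschitzOnWith.absolutelyContinuousOnInterval
  have hsub : ∀ t ∈ uIcc a b, IntervalIntegrable u volume a t := fun t ht =>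
    hu.mono_set (uIcc_subset_uIcc_left ht)
  refine hc.add (absolutelyContinuousOnInterval_of_re_im ?_ ?_)
  · refine (IntervalIntegrable.absolutelyContinuousOnInterval_intervalIntegral
      (f := fun t => Complex.reCLM (u t)) (c := a)
      ⟨Complex.reCLM.integrable_comp hu.1, Complex.reCLM.integrable_comp hu.2⟩
      left_mem_uIcc).congr fun t ht => ?_
    exact Complex.reCLM.intervalIntegral_comp_comm (hsub t ht)
  · refine (IntervalIntegrable.absolutelyContinuousOnInterval_intervalIntegral
      (f := fun t => Complex.imCLM (u t)) (c := a)
      ⟨Complex.imCLM.integrable_comp hu.1, Complex.imCLM.integrable_comp hu.2⟩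
      left_mem_uIcc).congr fun t ht => ?_
    exact Complex.imCLM.intervalIntegral_comp_comm (hsub t ht)

/-- The fundamental theorem of calculus for real absolutely continuous functions, applied to the
real and imaginary parts. -/
theorem AbsolutelyContinuousOnInterval.exists_eq_primitive {f : ℝ → ℂ} {a b : ℝ} (hab : a ≤ b)
    (hf : AbsolutelyContinuousOnInterval f a b) :
    ∃ u : L1Space a b, ∀ t ∈ Icc a b, f t = f a + ∫ s in a..t, u s := by
  have h1 := Complex.reCLM.lipschitz.comp_absolutelyContinuousOnInterval hf
  have h2 := Complex.imCLM.lipschitz.comp_absolutelyContinuousOnInterval hf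
  have i1 := h1.intervalIntegrable_deriv
  have i2 := h2.intervalIntegrable_deriv
  set g1 := fun t => Complex.reCLM (f t)
  set g2 := fun t => Complex.imCLM (f t)
  have i : Integrable (fun t => ((deriv g1 t : ℝ) : ℂ) + ((deriv g2 t : ℝ) : ℂ) * Complex.I)
      (volume.restrict (Icc a b)) := by
    rw [intervalIntegrable_iff_integrableOn_Icc_of_le hab] at i1 i2
    exact i1.ofReal.add (i2.ofReal.mul_const _)
  refine ⟨i.toL1 _, fun t ht => ?_⟩
  have hsub : uIcc a t ⊆ uIcc a b := by
    rw [uIcc_of_le ht.1, uIcc_of_le hab]; exact Icc_subset_Icc_right ht.2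
  have e : ∫ s in a..t, i.toL1 _ s =
      ∫ s in a..t, (((deriv g1 s : ℝ) : ℂ) + ((deriv g2 s : ℝ) : ℂ) * Complex.I) := by
    refine intervalIntegral.integral_congr_ae ?_
    have h3 := (ae_restrict_iff' measurableSet_Icc).1 i.coeFn_toL1
    filter_upwards [h3] with s hs hst
    rw [uIoc_of_le ht.1] at hst
    exact hs ⟨hst.1.le, hst.2.trans ht.2⟩
  rw [e, intervalIntegral.integral_add, intervalIntegral.integral_mul_const,
    intervalIntegral.integral_ofReal, intervalIntegral.integral_ofReal,
    (h1.mono hsub).integral_deriv_eq_sub, (h2.mono hsub).integral_deriv_eq_sub]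
  · apply Complex.ext <;> simp [g1, g2]
  · exact ⟨(i1.mono_set hsub).1.ofReal, (i1.mono_set hsub).2.ofReal⟩
  · exact IntervalIntegrable.mul_const
      ⟨(i2.mono_set hsub).1.ofReal, (i2.mono_set hsub).2.ofReal⟩ _

end AbsolutelyContinuous

/-! ### Integrals and products of `L_1` functions -/

section L1

variable {a b : ℝ}

theorem L1Space.intervalIntegrable (u : L1Space a b) {t : ℝ} (ht : t ∈ Icc a b) :
    IntervalIntegrable u volume a t := by
  rw [intervalIntegrable_iff_integrableOn_Icc_of_le ht.1]
  exact IntegrableOn.mono_set (L1.integrable_coeFn u) (Icc_subset_Icc_right ht.2)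

theorem L1Space.norm_integral_le (u : L1Space a b) {t : ℝ} (ht : t ∈ Icc a b) :
    ‖∫ s in a..t, u s‖ ≤ ‖u‖ := by
  rw [intervalIntegral.integral_of_le ht.1, L1.norm_eq_integral_norm]
  refine (norm_integral_le_integral_norm _).trans ?_
  refine setIntegral_mono_set (L1.integrable_coeFn u).norm
    (Eventually.of_forall fun _ => norm_nonneg _) (LE.le.eventuallyLE ?_)
  exact fun s hs => ⟨hs.1.le, hs.2.trans ht.2⟩

theorem L1Space.continuousOn_primitive [hab : Fact (a < b)] (c : ℂ) (u : L1Space a b) :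
    ContinuousOn (fun t => c + ∫ s in a..t, u s) (Icc a b) := by
  have h := intervalIntegral.continuousOn_primitive_interval (μ := volume) (f := u) (a := a)
    (b := b) (by rw [uIcc_of_le hab.out.le]; exact L1.integrable_coeFn u)
  rw [uIcc_of_le hab.out.le] at h
  exact continuousOn_const.add h

theorem L1Space.lintegral_enorm (u : L1Space a b) : ∫⁻ t in Icc a b, ‖u t‖ₑ = ‖u‖ₑ := by
  rw [Lp.enorm_def, eLpNorm_one_eq_lintegral_enorm]

theorem L1Space.integrable_mul_IccExtend [hab : Fact (a < b)] (u : L1Space a b) (g : C(Icc a b, ℂ)) :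
    Integrable (fun t => u t * IccExtend hab.out.le g t) (volume.restrict (Icc a b)) :=
  (L1.integrable_coeFn u).mul_bdd (c := ‖g‖) g.continuous.Icc_extend'.aestronglyMeasurable
    (Eventually.of_forall fun _ => g.norm_coe_le_norm _)

theorem L1Space.integral_coeFn_add (u v : L1Space a b) {t : ℝ} (ht : t ∈ Icc a b) :
    ∫ s in a..t, (u + v) s = (∫ s in a..t, u s) + ∫ s in a..t, v s := by
  rw [← intervalIntegral.integral_add (u.intervalIntegrable ht) (v.intervalIntegrable ht)]
  refine intervalIntegral.integral_congr_ae ?_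
  filter_upwards [(ae_restrict_iff' measurableSet_Icc).1 (Lp.coeFn_add u v)] with s hs hst
  rw [uIoc_of_le ht.1] at hst
  exact hs ⟨hst.1.le, hst.2.trans ht.2⟩

theorem L1Space.integral_coeFn_smul (c : ℂ) (u : L1Space a b) {t : ℝ} (ht : t ∈ Icc a b) :
    ∫ s in a..t, (c • u) s = c * ∫ s in a..t, u s := by
  rw [← intervalIntegral.integral_const_mul]
  refine intervalIntegral.integral_congr_ae ?_
  filter_upwards [(ae_restrict_iff' measurableSet_Icc).1 (Lp.coeFn_smul c u)] with s hs hst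
  rw [uIoc_of_le ht.1] at hst
  exact hs ⟨hst.1.le, hst.2.trans ht.2⟩

/-- Multiplication of an integrable function by a continuous one. -/
noncomputable def mulL1 [hab : Fact (a < b)] :
    L1Space a b →L[ℂ] C(Icc a b, ℂ) →L[ℂ] L1Space a b := by
  refine LinearMap.mkContinuous₂ (LinearMap.mk₂ ℂ (fun u g => (L1Space.integrable_mul_IccExtend u g).toL1) ?_ ?_ ?_ ?_) 1 ?_
  · intro u v g
    rw [← Integrable.toL1_add]
    rw [Integrable.toL1_eq_toL1_iff]
    filter_upwards [Lp.coeFn_add u v] with t ht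
    rw [ht, Pi.add_apply, add_mul, Pi.add_apply]
  · intro c u g
    rw [← Integrable.toL1_smul, Integrable.toL1_eq_toL1_iff]
    filter_upwards [Lp.coeFn_smul c u] with t ht
    rw [ht, Pi.smul_apply, smul_mul_assoc]
  · intro u g h
    rw [← Integrable.toL1_add, Integrable.toL1_eq_toL1_iff]
    filter_upwards with t
    simp [IccExtend, mul_add]
  · intro c u g
    rw [← Integrable.toL1_smul, Integrable.toL1_eq_toL1_iff]
    filter_upwards with t
    simp [IccExtend, mul_left_comm]
  · intro u g
    rw [one_mul, LinearMap.mk₂_apply, L1.norm_eq_integral_norm, L1.norm_eq_integral_norm,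
      ← integral_mul_const]
    refine integral_mono_ae (L1.integrable_coeFn _).norm
      ((L1.integrable_coeFn _).norm.mul_const _) ?_
    filter_upwards [(L1Space.integrable_mul_IccExtend u g).coeFn_toL1] with t ht
    rw [ht, norm_mul]
    exact mul_le_mul_of_nonneg_left (g.norm_coe_le_norm _) (norm_nonneg _)

theorem coeFn_mulL1 [hab : Fact (a < b)] (u : L1Space a b) (g : C(Icc a b, ℂ)) :
    mulL1 u g =ᵐ[volume.restrict (Icc a b)] fun t => u t * IccExtend hab.out.le g t :=
  (L1Space.integrable_mul_IccExtend u g).coeFn_toL1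

end L1

/-! ### Parametrization of `W_1^r` by Taylor data and top derivative -/

namespace CSpace

variable {a b : ℝ} [hab : Fact (a < b)] {n : ℕ}

/-- A function of class `C^{(n)}` with absolutely continuous `n`-th derivative is determined by its
Taylor coefficients at `a` and its derivative of order `n + 1`. -/
theorem exists_D_eq_primitive (p : (Fin n → ℂ) × ℂ × L1Space a b) :
    ∃ x : CSpace a b n, (∀ l : Fin n, x.D l a = p.1 l) ∧
      ∀ t ∈ Icc a b, x.D n t = p.2.1 + ∫ s in a..t, p.2.2 s := by
  obtain ⟨x, h1, h2⟩ := exists_D_eq (fun l => if h : l < n then p.1 ⟨l, h⟩ else 0)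
    (p.2.2.continuousOn_primitive p.2.1)
  exact ⟨x, fun l => by simp [h1 l l.2], h2⟩

/-- The function with given Taylor coefficients at `a` and given derivative of order `n + 1`. -/
noncomputable def ofDerivs (p : (Fin n → ℂ) × ℂ × L1Space a b) : CSpace a b n :=
  (exists_D_eq_primitive p).choose

theorem D_ofDerivs_left (p : (Fin n → ℂ) × ℂ × L1Space a b) (l : Fin n) :
    (ofDerivs p).D l a = p.1 l :=
  (exists_D_eq_primitive p).choose_spec.1 l

theorem D_ofDerivs (p : (Fin n → ℂ) × ℂ × L1Space a b) {t : ℝ} (ht : t ∈ Icc a b) :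
    (ofDerivs p).D n t = p.2.1 + ∫ s in a..t, p.2.2 s :=
  (exists_D_eq_primitive p).choose_spec.2 t ht

/-- Uniqueness makes the chosen function depend linearly on its data. -/
theorem eq_ofDerivs {x : CSpace a b n} {p : (Fin n → ℂ) × ℂ × L1Space a b}
    (h1 : ∀ l : Fin n, x.D l a = p.1 l)
    (h2 : ∀ t ∈ Icc a b, x.D n t = p.2.1 + ∫ s in a..t, p.2.2 s) : x = ofDerivs p :=
  eq_of_D_eq (fun l hl => (h1 ⟨l, hl⟩).trans (D_ofDerivs_left p ⟨l, hl⟩).symm)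
    (fun t ht => (h2 t ht).trans (D_ofDerivs p ht).symm)

/-- `ofDerivs` as a linear map. -/
noncomputable def ofDerivsₗ : ((Fin n → ℂ) × ℂ × L1Space a b) →ₗ[ℂ] CSpace a b n where
  toFun := ofDerivs
  map_add' p q := by
    refine (eq_ofDerivs (fun l => ?_) fun t ht => ?_).symm
    · rw [D_add (by omega) _ _ left_mem, D_ofDerivs_left, D_ofDerivs_left]; rfl
    · rw [D_add le_rfl _ _ ht, D_ofDerivs _ ht, D_ofDerivs _ ht, Prod.snd_add, Prod.snd_add,
        L1Space.integral_coeFn_add _ _ ht, Prod.fst_add]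
      ring
  map_smul' c p := by
    refine (eq_ofDerivs (fun l => ?_) fun t ht => ?_).symm
    · rw [RingHom.id_apply, D_smul (by omega) _ _ left_mem, D_ofDerivs_left]; rfl
    · rw [RingHom.id_apply, D_smul le_rfl _ _ ht, D_ofDerivs _ ht, Prod.smul_snd, Prod.smul_snd,
        L1Space.integral_coeFn_smul _ _ ht, Prod.smul_fst, smul_eq_mul]
      ring

theorem continuous_ofDerivsₗ :
    Continuous (ofDerivsₗ : ((Fin n → ℂ) × ℂ × L1Space a b) →ₗ[ℂ] CSpace a b n) := by
  have h1 : Continuous ((ofDerivsₗ : _ →ₗ[ℂ] CSpace a b n).comp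
      (LinearMap.inl ℂ (Fin n → ℂ) (ℂ × L1Space a b))) :=
    LinearMap.continuous_of_finiteDimensional _
  have h2 : Continuous ((ofDerivsₗ : _ →ₗ[ℂ] CSpace a b n).comp
      (LinearMap.inr ℂ (Fin n → ℂ) (ℂ × L1Space a b))) := by
    -- The factor `2` bounds `‖q.1‖ + ‖q.2‖` by the maximum norm of the product.
    refine AddMonoidHomClass.continuous_of_bound _
      (2 * ∑ j : Fin (n + 1), (b - a) ^ (n - j)) fun q => ?_
    have hs : 0 ≤ ∑ j : Fin (n + 1), (b - a) ^ (n - (j : ℕ)) :=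
      Finset.sum_nonneg fun _ _ => pow_nonneg (sub_nonneg.2 hab.out.le) _
    have h3 := norm_le_of_vanishing (ofDerivs ((0 : Fin n → ℂ), q)) (ε := ‖q.1‖ + ‖q.2‖)
      (fun l hl => D_ofDerivs_left _ ⟨l, hl⟩) (fun t ht => by
        rw [D_ofDerivs _ ht]
        exact (norm_add_le _ _).trans (by gcongr; exact q.2.norm_integral_le ht))
    refine h3.trans ?_
    have h4 := norm_fst_le q
    have h5 := norm_snd_le q
    rw [mul_comm 2, mul_assoc, mul_comm]
    exact mul_le_mul_of_nonneg_left (by linarith) hs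
  have h : ⇑(ofDerivsₗ : ((Fin n → ℂ) × ℂ × L1Space a b) →ₗ[ℂ] CSpace a b n) = fun p =>
      ((ofDerivsₗ : _ →ₗ[ℂ] CSpace a b n).comp (LinearMap.inl ℂ _ _)) p.1 +
      ((ofDerivsₗ : _ →ₗ[ℂ] CSpace a b n).comp (LinearMap.inr ℂ _ _)) p.2 := by
    funext p
    rw [LinearMap.comp_apply, LinearMap.comp_apply, ← map_add]
    simp
  rw [h]
  exact (h1.comp continuous_fst).add (h2.comp continuous_snd)

/-- `ofDerivs` as a continuous linear operator. -/
noncomputable def ofDerivsL : ((Fin n → ℂ) × ℂ × L1Space a b) →L[ℂ] CSpace a b n :=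
  ⟨ofDerivsₗ, continuous_ofDerivsₗ⟩

theorem absolutelyContinuousOnInterval_D_ofDerivs (p : (Fin n → ℂ) × ℂ × L1Space a b) :
    AbsolutelyContinuousOnInterval ((ofDerivs p).D n) a b := by
  have h := absolutelyContinuousOnInterval_primitive
    (p.2.2.intervalIntegrable (right_mem_Icc.2 hab.out.le)) p.2.1
  refine h.congr fun t ht => (D_ofDerivs p ?_).symm
  rwa [uIcc_of_le hab.out.le] at ht

/-- Lebesgue differentiation of the primitive. The end points are discarded so that the derivative
within `[a,b]` is the ordinary one. -/
theorem D_succ_ofDerivs (p : (Fin n → ℂ) × ℂ × L1Space a b) :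
    (ofDerivs p).D (n + 1) =ᵐ[volume.restrict (Icc a b)] p.2.2 := by
  have h := (p.2.2.intervalIntegrable (right_mem_Icc.2 hab.out.le)).ae_hasDerivAt_integral
  have h₁ : ∀ᵐ t : ℝ, t ≠ a := by simp [ae_iff, measure_singleton]
  have h₂ : ∀ᵐ t : ℝ, t ≠ b := by simp [ae_iff, measure_singleton]
  rw [EventuallyEq, ae_restrict_iff' measurableSet_Icc]
  filter_upwards [h, h₁, h₂] with t ht hta htb hmem
  have htt : t ∈ Ioo a b := ⟨lt_of_le_of_ne hmem.1 hta.symm, lt_of_le_of_ne hmem.2 htb⟩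
  have h1 := (ht (by rw [uIcc_of_le hab.out.le]; exact Ioo_subset_Icc_self htt) a
    left_mem_uIcc).const_add p.2.1
  rw [D, iteratedDerivWithin_succ, derivWithin_of_mem_nhds (Icc_mem_nhds htt.1 htt.2)]
  refine (h1.congr_of_eventuallyEq ?_).deriv
  filter_upwards [Icc_mem_nhds htt.1 htt.2] with s hs using D_ofDerivs p hs

theorem exists_eq_ofDerivs {x : CSpace a b n} (hx : AbsolutelyContinuousOnInterval (x.D n) a b) :
    ∃ p, x = ofDerivs p := by
  obtain ⟨u, hu⟩ := hx.exists_eq_primitive hab.out.le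
  exact ⟨(fun l => x.D l a, x.D n a, u), eq_ofDerivs (fun _ => rfl) hu⟩

end CSpace

/-! ### Hat functions and piecewise linear interpolation -/

section PiecewiseLinear

/-- On the old interval the new hat vanishes; on the added unit interval only the last two hats
contribute. -/
theorem sum_max_zero_one_sub_abs (N : ℕ) {s : ℝ} (h0 : 0 ≤ s) (hN : s ≤ N) :
    ∑ j ∈ Finset.range (N + 1), max 0 (1 - |s - j|) = 1 := by
  induction N with
  | zero =>
    obtain rfl : s = 0 := le_antisymm (by simpa using hN) h0
    simp
  | succ N ih =>
    push_cast at hN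
    rw [Finset.sum_range_succ]
    rcases le_total s N with h | h
    · rw [ih h, max_eq_left, add_zero]
      push_cast
      rw [abs_of_nonpos (by linarith)]
      linarith
    · rw [Finset.sum_range_succ, Finset.sum_eq_zero]
      · push_cast
        rw [abs_of_nonneg (by linarith), abs_of_nonpos (by linarith), max_eq_right (by linarith),
          max_eq_right (by linarith)]
        ring
      · intro j hj
        have hj' : (j : ℝ) + 1 ≤ N := by exact_mod_cast Finset.mem_range.1 hj
        rw [max_eq_left]
        rw [abs_of_nonneg (by linarith)]
        linarith

variable {a b : ℝ} [hab : Fact (a < b)]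

theorem hat_eq {N : ℕ} (hN : 0 < N) (j : ℕ) (t : ℝ) :
    hat a b N j t = ((max 0 (1 - |(t - a) * N / (b - a) - j|) : ℝ) : ℂ) := by
  have h0 : 0 < b - a := sub_pos.2 hab.out
  have hN' : (0 : ℝ) < N := by exact_mod_cast hN
  have h : |t - node a b N j| * N / (b - a) = |(t - a) * N / (b - a) - j| := by
    rw [← abs_of_pos hN', ← abs_mul, ← abs_of_pos h0, ← abs_div, abs_of_pos hN', abs_of_pos h0]
    congr 1
    unfold node
    field_simp
    ring
  rw [hat, h]

theorem sum_hat {N : ℕ} (hN : 0 < N) {t : ℝ} (ht : t ∈ Icc a b) :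
    ∑ j ∈ Finset.range (N + 1), hat a b N j t = 1 := by
  have h0 : 0 < b - a := sub_pos.2 hab.out
  have h := sum_max_zero_one_sub_abs N (s := (t - a) * N / (b - a))
    (div_nonneg (mul_nonneg (by linarith [ht.1]) (Nat.cast_nonneg _)) h0.le)
    (by
      rw [div_le_iff₀ h0, mul_comm]
      exact mul_le_mul_of_nonneg_left (by linarith [ht.2]) (Nat.cast_nonneg _))
  simp only [hat_eq hN]
  exact_mod_cast congrArg (fun x : ℝ => (x : ℂ)) h

theorem sum_norm_hat {N : ℕ} (hN : 0 < N) {t : ℝ} (ht : t ∈ Icc a b) :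
    ∑ j ∈ Finset.range (N + 1), ‖hat a b N j t‖ = 1 := by
  have h := sum_hat hN ht
  have h1 : ∀ j, hat a b N j t = (‖hat a b N j t‖ : ℂ) := fun j => by
    rw [hat, Complex.norm_real, Real.norm_of_nonneg (le_max_left _ _)]
  have h2 : ∑ j ∈ Finset.range (N + 1), (‖hat a b N j t‖ : ℂ) = 1 :=
    (Finset.sum_congr rfl fun j _ => (h1 j).symm).trans h
  exact_mod_cast h2

theorem abs_sub_node_lt_of_hat_ne_zero {N j : ℕ} (hN : 0 < N) {t : ℝ} (h : hat a b N j t ≠ 0) :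
    |t - node a b N j| < (b - a) / N := by
  have h0 : 0 < b - a := sub_pos.2 hab.out
  have hN' : (0 : ℝ) < N := by exact_mod_cast hN
  by_contra hc
  apply h
  rw [hat, max_eq_left, Complex.ofReal_zero]
  rw [sub_nonpos, one_le_div h0]
  exact (div_le_iff₀ hN').1 (not_lt.1 hc)

/-- Piecewise linear interpolants of a continuous function converge uniformly. -/
theorem eventually_norm_sum_hat_sub_le {g : ℝ → ℂ} (hg : ContinuousOn g (Icc a b)) {ε : ℝ}
    (hε : 0 < ε) : ∀ᶠ k : ℕ in atTop, ∀ t ∈ Icc a b,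
      ‖∑ j ∈ Finset.range (k + 2), g (node a b (k + 1) j) * hat a b (k + 1) j t - g t‖ ≤ ε := by
  obtain ⟨δ, hδ, hu⟩ := Metric.uniformContinuousOn_iff.1
    (isCompact_Icc.uniformContinuousOn_of_continuous hg) ε hε
  have hlim : Tendsto (fun k : ℕ => (b - a) / ((k + 1 : ℕ) : ℝ)) atTop (𝓝 0) :=
    (tendsto_const_div_atTop_nhds_zero_nat (b - a)).comp (tendsto_add_atTop_nat 1)
  filter_upwards [hlim.eventually (gt_mem_nhds hδ)] with k hk t ht
  -- The hats form a partition of unity, so the error is an average of `g (t_j) - g t` in which only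
  -- nodes within one mesh width of `t` have nonzero weight.
  have h1 : ∑ j ∈ Finset.range (k + 2), g (node a b (k + 1) j) * hat a b (k + 1) j t - g t =
      ∑ j ∈ Finset.range (k + 2), (g (node a b (k + 1) j) - g t) * hat a b (k + 1) j t := by
    simp only [sub_mul]
    rw [Finset.sum_sub_distrib, ← Finset.mul_sum, sum_hat k.succ_pos ht, mul_one]
  rw [h1]
  refine (norm_sum_le _ _).trans ?_
  calc _ ≤ ∑ j ∈ Finset.range (k + 2), ε * ‖hat a b (k + 1) j t‖ := by
        refine Finset.sum_le_sum fun j hj => ?_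
        rw [norm_mul]
        by_cases h : hat a b (k + 1) j t = 0
        · simp [h]
        · refine mul_le_mul_of_nonneg_right ?_ (norm_nonneg _)
          have h2 := (abs_sub_node_lt_of_hat_ne_zero k.succ_pos h).trans hk
          rw [← dist_eq_norm]
          refine (hu _ (node_mem a b k.succ_pos (by simpa [Nat.lt_succ_iff] using hj)) _ ht ?_).le
          rwa [dist_comm, Real.dist_eq]
    _ = ε := by rw [← Finset.mul_sum, sum_norm_hat k.succ_pos ht, mul_one]

end PiecewiseLinear

/-! ### The interpolation operators on `C^{(n)}` -/

namespace CSpace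

variable {a b : ℝ} [hab : Fact (a < b)] {n : ℕ}

/-- The function with the same Taylor coefficients at `a` as `x` of order less than `n`, whose
`n`-th derivative is the piecewise linear interpolant of that of `x` at `k + 2` nodes. -/
noncomputable def interp (k : ℕ) (x : CSpace a b n) : CSpace a b n :=
  ∑ l : Fin n, x.D l a • taylorMonomial a b n l +
    ∑ j : Fin (k + 2), x.D n (node a b (k + 1) j) • hatAntideriv a b n (k + 1) j

theorem D_interp_left (k : ℕ) (x : CSpace a b n) {i : ℕ} (hi : i < n) :
    (interp k x).D i a = x.D i a := by
  rw [interp, D_add hi.le _ _ left_mem, D_sum _ hi.le _ left_mem, D_sum _ hi.le _ left_mem,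
    Finset.sum_eq_single_of_mem ⟨i, hi⟩ (Finset.mem_univ _), Finset.sum_eq_zero, add_zero]
  · rw [D_smul hi.le _ _ left_mem, D_taylorMonomial hi.le left_mem]
    simp
  · intro j _
    obtain ⟨d, hd⟩ := Nat.exists_eq_add_of_lt hi
    have h := iteratedDeriv_iterAntideriv a (continuous_hat a b (k + 1) j) i (d + 1)
    rw [show d + 1 + i = n by omega] at h
    rw [D_smul hi.le _ _ left_mem, hatAntideriv, D_ofContDiff hi.le _ _ left_mem, h,
      iterAntideriv_succ_self, mul_zero]
  · intro l _ hli
    have hne : (l : ℕ) ≠ i := fun h => hli (Fin.ext h)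
    rw [D_smul hi.le _ _ left_mem, D_taylorMonomial hi.le left_mem]
    split_ifs with h
    · rw [sub_self, zero_pow (by omega)]; simp
    · simp

theorem D_interp (k : ℕ) (x : CSpace a b n) {t : ℝ} (ht : t ∈ Icc a b) :
    (interp k x).D n t =
      ∑ j ∈ Finset.range (k + 2), x.D n (node a b (k + 1) j) * hat a b (k + 1) j t := by
  rw [interp, D_add le_rfl _ _ ht, D_sum _ le_rfl _ ht, D_sum _ le_rfl _ ht,
    Finset.sum_eq_zero, zero_add, Finset.sum_range]
  · refine Finset.sum_congr rfl fun j _ => ?_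
    have h := iteratedDeriv_iterAntideriv a (continuous_hat a b (k + 1) j) n 0
    rw [zero_add] at h
    rw [D_smul le_rfl _ _ ht, hatAntideriv, D_ofContDiff le_rfl _ _ ht, h]
    rfl
  · intro l _
    rw [D_smul le_rfl _ _ ht, D_taylorMonomial le_rfl ht, if_neg (by omega), mul_zero]

theorem tendsto_interp (x : CSpace a b n) : Tendsto (fun k => interp k x) atTop (𝓝 x) := by
  set K := ∑ j : Fin (n + 1), (b - a) ^ (n - (j : ℕ))
  have hK : 0 ≤ K :=
    Finset.sum_nonneg fun _ _ => pow_nonneg (sub_nonneg.2 hab.out.le) _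
  rw [Metric.tendsto_nhds]
  intro ε hε
  -- Using `K + 1` in place of `K` makes the final bound strict.
  have hε' : 0 < ε / (K + 1) := by positivity
  filter_upwards [eventually_norm_sum_hat_sub_le (x.continuousOn_D le_rfl) hε'] with k hk
  rw [dist_eq_norm]
  refine (norm_le_of_vanishing (interp k x - x) (ε := ε / (K + 1)) (fun l hl => ?_)
    fun t ht => ?_).trans_lt ?_
  · rw [D_sub hl.le _ _ left_mem, D_interp_left k x hl, sub_self]
  · rw [D_sub le_rfl _ _ ht, D_interp k x ht]
    exact hk t ht
  · change ε / (K + 1) * K < ε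
    rw [div_mul_eq_mul_div, div_lt_iff₀ (by positivity)]
    linarith

end CSpace

/-! ### The explicit operator as `B` composed with interpolation -/

section ExplicitMultipoint

theorem Fin.sum_univ_eq_last_add {M : Type*} [AddCommMonoid M] {r : ℕ} (hr : 1 ≤ r)
    (f : Fin r → M) :
    ∑ l, f l = ∑ l : Fin (r - 1), f ⟨l, by omega⟩ + f ⟨r - 1, by omega⟩ := by
  obtain ⟨n, rfl⟩ : ∃ n, r = n + 1 := ⟨r - 1, by omega⟩
  exact Fin.sum_univ_castSucc f

variable {a b : ℝ} [hab : Fact (a < b)] {r m : ℕ}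

/-- The interpolant is a combination of Taylor monomials and hat antiderivatives with derivatives of
`y` as coefficients; the matrices are the values of `B` on these functions, so linearity suffices.
-/
theorem explicitMultipoint_op (hr : 1 ≤ r)
    (B : (Fin m → CSpace a b (r - 1)) →L[ℂ] (Fin (r * m) → ℂ)) (k : ℕ)
    (y : Fin m → CSpace a b (r - 1)) :
    (explicitMultipoint B k).op y = B fun i => (y i).interp k := by
  have h1 : (fun i => (y i).interp k) = ∑ i,
      (∑ l : Fin (r - 1), (y i).D l a •
          (Pi.single i (taylorMonomial a b (r - 1) l) : Fin m → CSpace a b (r - 1)) +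
        ∑ j : Fin (k + 2), (y i).D (r - 1) (node a b (k + 1) j) •
          (Pi.single i (hatAntideriv a b (r - 1) (k + 1) j) : Fin m → CSpace a b (r - 1))) := by
    rw [← Finset.univ_sum_single fun i => (y i).interp k]
    refine Finset.sum_congr rfl fun i _ => ?_
    simp only [← Pi.single_smul, CSpace.interp]
    simp only [← LinearMap.coe_single (R := ℂ), map_add, map_sum]
  rw [h1]
  simp only [map_sum, map_add, map_smul]
  funext s
  have hop : (explicitMultipoint B k).op y s = ∑ j : Fin (k + 2), ∑ l : Fin r, ∑ i,
      (if (l : ℕ) = r - 1 then B (Pi.single i (hatAntideriv a b (r - 1) (k + 1) j)) s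
        else if (j : ℕ) = 0 then B (Pi.single i (taylorMonomial a b (r - 1) l)) s
        else 0) * (y i).D l (node a b (k + 1) j) := by
    simp only [MultipointData.op, Finset.sum_apply]
    rfl
  rw [hop]
  simp only [Finset.sum_apply, Pi.add_apply, Pi.smul_apply, smul_eq_mul]
  simp only [Fin.sum_univ_eq_last_add hr, if_true]
  have hl : ∀ l : Fin (r - 1), ¬ ((l : ℕ) = r - 1) := fun l => l.2.ne
  simp only [hl, if_false]
  rw [Finset.sum_add_distrib]
  rw [Finset.sum_add_distrib]
  congr 1
  -- The lower-order terms are carried by the node `j = 0` alone, which is the point `a`.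
  · rw [Fin.sum_univ_succ]
    simp only [Fin.val_zero, Fin.val_succ, if_true, Nat.succ_ne_zero, if_false, zero_mul,
      Finset.sum_const_zero, add_zero]
    rw [Finset.sum_comm]
    refine Finset.sum_congr rfl fun i _ => Finset.sum_congr rfl fun l _ => ?_
    rw [mul_comm]
    simp [node]
  · rw [Finset.sum_comm]
    refine Finset.sum_congr rfl fun i _ => Finset.sum_congr rfl fun l _ => ?_
    rw [mul_comm]

theorem tendsto_explicitMultipoint_op (hr : 1 ≤ r)
    (B : (Fin m → CSpace a b (r - 1)) →L[ℂ] (Fin (r * m) → ℂ)) (y : Fin m → CSpace a b (r - 1)) :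
    Tendsto (fun k => (explicitMultipoint B k).op y) atTop (𝓝 (B y)) := by
  simp only [explicitMultipoint_op hr B]
  exact (B.continuous.tendsto y).comp
    (tendsto_pi_nhds.2 fun i => CSpace.tendsto_interp (y i))

end ExplicitMultipoint

/-! ### The boundary-value problem as an operator equation -/

section Operator

variable {a b : ℝ} [hab : Fact (a < b)] {r m : ℕ}

/-- The evaluation of a derivative of order at most `n` as a continuous linear functional. -/
noncomputable def CSpace.evalDerivL {n : ℕ} (l : ℕ) (hl : l ≤ n) (t : Icc a b) :
    CSpace a b n →L[ℂ] ℂ :=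
  (ContinuousMap.evalCLM ℂ t).comp (CSpace.derivL l hl)

/-- A multipoint operator as a continuous linear operator. -/
noncomputable def MultipointData.opL (M : MultipointData a b r m) :
    (Fin m → CSpace a b (r - 1)) →L[ℂ] (Fin (r * m) → ℂ) :=
  ∑ j, ∑ l : Fin r, (LinearMap.toContinuousLinearMap (M.β j l).mulVecLin).comp
    (ContinuousLinearMap.pi fun i =>
      (CSpace.evalDerivL (l : ℕ) (by omega) (M.t j)).comp (ContinuousLinearMap.proj i))

theorem MultipointData.coe_opL (M : MultipointData a b r m) : ⇑M.opL = M.op := by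
  funext y
  simp only [MultipointData.opL, MultipointData.op, _root_.sum_apply]
  rfl

/-- Functions in `(W_1^r)^m` are parametrized by their Taylor coefficients at `a` of order less
than `r - 1`, that of order `r - 1`, and their derivatives of order `r`. -/
abbrev SobolevData (a b : ℝ) (r m : ℕ) : Type :=
  Fin m → (Fin (r - 1) → ℂ) × ℂ × L1Space a b

/-- The parametrization of `(W_1^r)^m`. -/
noncomputable def sobolevL : SobolevData a b r m →L[ℂ] (Fin m → CSpace a b (r - 1)) :=
  ContinuousLinearMap.pi fun i => CSpace.ofDerivsL.comp (ContinuousLinearMap.proj i)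

theorem D_sobolevL (hr : 1 ≤ r) (e : SobolevData a b r m) (i : Fin m) :
    (sobolevL e i).D r =ᵐ[volume.restrict (Icc a b)] (e i).2.2 := by
  have h := CSpace.D_succ_ofDerivs (e i)
  rwa [Nat.sub_add_cancel hr] at h

theorem sobolevL_mem (e : SobolevData a b r m) (i : Fin m) : sobolevL e i ∈ sobolevW a b r :=
  CSpace.absolutelyContinuousOnInterval_D_ofDerivs (e i)

theorem exists_eq_sobolevL {y : Fin m → CSpace a b (r - 1)} (hy : ∀ i, y i ∈ sobolevW a b r) :
    ∃ e : SobolevData a b r m, y = sobolevL e := by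
  choose e he using fun i => CSpace.exists_eq_ofDerivs (hy i)
  exact ⟨e, funext he⟩

theorem sobolevL_injective (hr : 1 ≤ r) :
    Function.Injective (sobolevL : SobolevData a b r m →L[ℂ] _) := by
  intro e e' h
  funext i
  have hi : CSpace.ofDerivs (e i) = CSpace.ofDerivs (e' i) := congrFun h i
  refine Prod.ext (funext fun l => ?_) (Prod.ext ?_ (Lp.ext ?_))
  · rw [← CSpace.D_ofDerivs_left (e i), ← CSpace.D_ofDerivs_left (e' i), hi]
  · have h1 := CSpace.D_ofDerivs (e i) CSpace.left_mem
    have h2 := CSpace.D_ofDerivs (e' i) CSpace.left_mem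
    rw [intervalIntegral.integral_same, add_zero] at h1 h2
    rw [← h1, ← h2, hi]
  · have h1 := D_sobolevL hr e i
    rw [h] at h1
    exact h1.symm.trans (D_sobolevL hr e' i)

/-- The differential operator in terms of the parametrization of `(W_1^r)^m`. -/
noncomputable def diffL (A : Fin r → Matrix (Fin m) (Fin m) (L1Space a b)) :
    SobolevData a b r m →L[ℂ] (Fin m → L1Space a b) :=
  ContinuousLinearMap.pi fun i =>
    (ContinuousLinearMap.snd ℂ _ _).comp
      ((ContinuousLinearMap.snd ℂ (Fin (r - 1) → ℂ) (ℂ × L1Space a b)).comp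
        (ContinuousLinearMap.proj i)) +
    ∑ l : Fin r, ∑ j : Fin m, (mulL1 (A l i j)).comp
      ((CSpace.derivL (l : ℕ) (by omega)).comp ((ContinuousLinearMap.proj j).comp sobolevL))

theorem coeFn_diffL (hr : 1 ≤ r) (A : Fin r → Matrix (Fin m) (Fin m) (L1Space a b))
    (e : SobolevData a b r m) (i : Fin m) :
    diffL A e i =ᵐ[volume.restrict (Icc a b)] fun t =>
      (sobolevL e i).D r t + ∑ l : Fin r, ∑ j : Fin m, A l i j t * (sobolevL e j).D l t := by
  have h : diffL A e i = (e i).2.2 + ∑ l : Fin r, ∑ j : Fin m,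
      mulL1 (A l i j) (CSpace.derivL (l : ℕ) (by omega) (sobolevL e j)) := by
    simp only [diffL, ContinuousLinearMap.pi_apply, _root_.add_apply, _root_.sum_apply]
    rfl
  have h1 := fun l : Fin r => Lp.coeFn_fun_finsetSum Finset.univ fun j : Fin m =>
      mulL1 (A l i j) (CSpace.derivL (l : ℕ) (by omega) (sobolevL e j))
  have h2 := fun (l : Fin r) (j : Fin m) =>
      coeFn_mulL1 (A l i j) (CSpace.derivL (l : ℕ) (by omega) (sobolevL e j))
  rw [h]
  filter_upwards [Lp.coeFn_add (e i).2.2 (∑ l : Fin r, ∑ j : Fin m,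
      mulL1 (A l i j) (CSpace.derivL (l : ℕ) (by omega) (sobolevL e j))),
    Lp.coeFn_fun_finsetSum Finset.univ (fun l : Fin r => ∑ j : Fin m,
      mulL1 (A l i j) (CSpace.derivL (l : ℕ) (by omega) (sobolevL e j))),
    D_sobolevL hr e i, ae_all_iff.2 h1, ae_all_iff.2 fun l => ae_all_iff.2 (h2 l),
    ae_restrict_mem measurableSet_Icc] with t ht1 ht2 ht3 ht4 ht5 ht
  rw [ht1, Pi.add_apply, ht2, ht3]
  congr 1
  refine Finset.sum_congr rfl fun l _ => ?_
  rw [ht4 l]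
  refine Finset.sum_congr rfl fun j _ => ?_
  rw [ht5 l j, IccExtend_of_mem _ _ ht, CSpace.derivL_apply]

/-- The operator `(L, B)` of the boundary-value problem in terms of the parametrization of
`(W_1^r)^m`. -/
noncomputable def problemL (A : Fin r → Matrix (Fin m) (Fin m) (L1Space a b))
    (B : (Fin m → CSpace a b (r - 1)) →L[ℂ] (Fin (r * m) → ℂ)) :
    SobolevData a b r m →L[ℂ] (Fin m → L1Space a b) × (Fin (r * m) → ℂ) :=
  (diffL A).prod (B.comp sobolevL)

theorem isSolution_sobolevL_iff (hr : 1 ≤ r) (A : Fin r → Matrix (Fin m) (Fin m) (L1Space a b))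
    (B : (Fin m → CSpace a b (r - 1)) →L[ℂ] (Fin (r * m) → ℂ)) (f : Fin m → L1Space a b)
    (q : Fin (r * m) → ℂ) (e : SobolevData a b r m) :
    IsSolution A B f q (sobolevL e) ↔ problemL A B e = (f, q) := by
  have h : problemL A B e = (diffL A e, B (sobolevL e)) := rfl
  rw [h, Prod.mk.injEq, IsSolution]
  constructor
  · rintro ⟨-, h1, h2⟩
    exact ⟨funext fun i => Lp.ext ((coeFn_diffL hr A e i).trans (h1 i)), h2⟩
  · rintro ⟨h1, h2⟩
    refine ⟨sobolevL_mem e, fun i => ?_, h2⟩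
    have h3 := coeFn_diffL hr A e i
    rw [h1] at h3
    exact h3.symm

theorem uniquelySolvable_iff (hr : 1 ≤ r) (A : Fin r → Matrix (Fin m) (Fin m) (L1Space a b))
    (B : (Fin m → CSpace a b (r - 1)) →L[ℂ] (Fin (r * m) → ℂ)) :
    UniquelySolvable A B ↔ Function.Bijective (problemL A B) := by
  constructor
  · intro h
    refine ⟨fun e e' hee => ?_, fun z => ?_⟩
    · have h1 := (isSolution_sobolevL_iff hr A B _ _ e).2 rfl
      have h2 := (isSolution_sobolevL_iff hr A B _ _ e').2 hee.symm
      exact sobolevL_injective hr ((h _ _).unique h1 h2)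
    · obtain ⟨y, hy, -⟩ := h z.1 z.2
      obtain ⟨e, rfl⟩ := exists_eq_sobolevL hy.1
      exact ⟨e, (isSolution_sobolevL_iff hr A B _ _ e).1 hy⟩
  · intro h f q
    obtain ⟨e, he⟩ := h.2 (f, q)
    refine ⟨sobolevL e, (isSolution_sobolevL_iff hr A B _ _ e).2 he, fun y hy => ?_⟩
    obtain ⟨e', rfl⟩ := exists_eq_sobolevL hy.1
    rw [h.1 (((isSolution_sobolevL_iff hr A B _ _ e').1 hy).trans he.symm)]

/-- Derivatives of order below `r` are bounded by the `C^{(r-1)}` norm and integrated over length `b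
- a`; the top one contributes exactly its `L_1` norm. Hence convergence of the data gives
convergence in `(W_1^r)^m`. -/
theorem sobolevNorm_sobolevL_le (hr : 1 ≤ r) (e : SobolevData a b r m) :
    sobolevNorm (sobolevL e) ≤ ∑ i, (∑ _j ∈ Finset.range r,
      ENNReal.ofReal (b - a) * ‖sobolevL e i‖ₑ + ‖(e i).2.2‖ₑ) := by
  refine Finset.sum_le_sum fun i _ => ?_
  rw [Finset.sum_range_succ]
  refine add_le_add (Finset.sum_le_sum fun j hj => ?_) (le_of_eq ?_)
  · have hj' : j ≤ r - 1 := by have := Finset.mem_range.1 hj; omega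
    calc ∫⁻ t in Icc a b, ‖(sobolevL e i).D j t‖ₑ
        ≤ ∫⁻ _ in Icc a b, ‖sobolevL e i‖ₑ := by
          refine setLIntegral_mono' measurableSet_Icc fun t ht => ?_
          rw [enorm_le_iff_norm_le]
          exact CSpace.norm_D_le hj' _ ht
      _ = _ := by rw [setLIntegral_const, Real.volume_Icc, mul_comm]
  · rw [← L1Space.lintegral_enorm]
    refine lintegral_congr_ae ?_
    filter_upwards [D_sobolevL hr e i] with t ht
    rw [ht]

theorem tendsto_sobolevNorm_sobolevL (hr : 1 ≤ r) {e : ℕ → SobolevData a b r m}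
    (he : Tendsto e atTop (𝓝 0)) :
    Tendsto (fun k => sobolevNorm (sobolevL (e k))) atTop (𝓝 0) := by
  refine tendsto_of_tendsto_of_tendsto_of_le_of_le tendsto_const_nhds ?_ (fun _ => zero_le)
    fun k => sobolevNorm_sobolevL_le hr (e k)
  have hc : Continuous fun e : SobolevData a b r m => ∑ i, (∑ _j ∈ Finset.range r,
      ENNReal.ofReal (b - a) * ‖sobolevL e i‖ₑ + ‖(e i).2.2‖ₑ) := by
    refine continuous_finsetSum _ fun i _ => Continuous.add
      (continuous_finsetSum _ fun _ _ => ?_) ?_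
    · exact (ENNReal.continuous_const_mul ENNReal.ofReal_ne_top).comp
        (continuous_enorm.comp ((continuous_apply i).comp sobolevL.continuous))
    · exact continuous_enorm.comp
        (continuous_snd.comp (continuous_snd.comp (continuous_apply i)))
  have h := (hc.tendsto 0).comp he
  simpa [Function.comp_def] using h

theorem ContinuousLinearMap.tendsto_pi {α ι E : Type*} [Fintype ι] [DecidableEq ι]
    {F : ι → Type*} [NormedAddCommGroup E] [NormedSpace ℂ E] [∀ i, NormedAddCommGroup (F i)]
    [∀ i, NormedSpace ℂ (F i)] {l : Filter α} {f : α → ∀ i, E →L[ℂ] F i} {g : ∀ i, E →L[ℂ] F i}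
    (h : ∀ i, Tendsto (fun k => f k i) l (𝓝 (g i))) :
    Tendsto (fun k => ContinuousLinearMap.pi (f k)) l (𝓝 (ContinuousLinearMap.pi g)) := by
  have hrep : ∀ f : ∀ i, E →L[ℂ] F i, ContinuousLinearMap.pi f =
      ∑ i, (ContinuousLinearMap.single ℂ F i).comp (f i) := fun f => by
    ext x i
    simp [_root_.sum_apply]
  simp only [hrep]
  exact tendsto_finsetSum _ fun i _ => ContinuousLinearMap.tendsto_comp tendsto_const_nhds (h i)

theorem tendsto_diffL {Ak : ℕ → Fin r → Matrix (Fin m) (Fin m) (L1Space a b)}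
    {A : Fin r → Matrix (Fin m) (Fin m) (L1Space a b)}
    (h : ∀ l, Tendsto (fun k => Ak k l) atTop (𝓝 (A l))) :
    Tendsto (fun k => diffL (Ak k)) atTop (𝓝 (diffL A)) := by
  refine ContinuousLinearMap.tendsto_pi fun i => tendsto_const_nhds.add
    (tendsto_finsetSum _ fun l _ => tendsto_finsetSum _ fun j _ =>
      ContinuousLinearMap.tendsto_comp ?_ tendsto_const_nhds)
  have h1 : Tendsto (fun k => Ak k l i j) atTop (𝓝 (A l i j)) :=
    tendsto_pi_nhds.1 (tendsto_pi_nhds.1 (h l) i) j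
  exact (mulL1.continuous.tendsto _).comp h1

/-- Approximation of a uniquely solvable problem under norm convergence of the coefficients and
pointwise convergence of the boundary operators. -/
theorem approximates_of_tendsto (hr : 1 ≤ r)
    {Ak : ℕ → Fin r → Matrix (Fin m) (Fin m) (L1Space a b)}
    {Bk : ℕ → (Fin m → CSpace a b (r - 1)) →L[ℂ] (Fin (r * m) → ℂ)}
    {A : Fin r → Matrix (Fin m) (Fin m) (L1Space a b)}
    {B : (Fin m → CSpace a b (r - 1)) →L[ℂ] (Fin (r * m) → ℂ)}
    (hAB : UniquelySolvable A B) (hA : ∀ l, Tendsto (fun k => Ak k l) atTop (𝓝 (A l)))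
    (hB : ∀ y, Tendsto (fun k => Bk k y) atTop (𝓝 (B y))) :
    Approximates Ak (fun k => Bk k) A B := by
  obtain ⟨h1, h2⟩ := eventually_bijective_of_tendsto ((uniquelySolvable_iff hr A B).1 hAB)
    (Pk := fun k => problemL (Ak k) (Bk k)) (tendsto_diffL hA) (fun e => hB (sobolevL e))
  refine ⟨?_, fun f q y yk hy hyk => ?_⟩
  · filter_upwards [h1] with k hk using (uniquelySolvable_iff hr _ _).2 hk
  · obtain ⟨e, rfl⟩ := exists_eq_sobolevL hy.1
    have he := (isSolution_sobolevL_iff hr A B f q e).1 hy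
    have hex : ∀ k, ∃ w : SobolevData a b r m,
        IsSolution (Ak k) (Bk k) f q (yk k) → yk k = sobolevL w := fun k => by
      by_cases hk : IsSolution (Ak k) (Bk k) f q (yk k)
      · obtain ⟨w, hw⟩ := exists_eq_sobolevL hk.1
        exact ⟨w, fun _ => hw⟩
      · exact ⟨0, fun h => absurd h hk⟩
    choose w hw using hex
    have hlim : Tendsto w atTop (𝓝 e) := by
      refine h2 (f, q) e w he ?_
      filter_upwards [hyk] with k hk
      have hk' := hk
      rw [hw k hk] at hk'
      exact (isSolution_sobolevL_iff hr _ _ f q (w k)).1 hk'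
    have h3 : Tendsto (fun k => w k - e) atTop (𝓝 0) := by
      simpa using hlim.sub_const e
    refine (tendsto_sobolevNorm_sobolevL hr h3).congr' ?_
    filter_upwards [hyk] with k hk
    rw [map_sub, hw k hk]

end Operator

/-! ### The main theorem -/

theorem mainTheorem1 (a b : ℝ) [Fact (a < b)] (r m : ℕ) (hr : 1 ≤ r) (hm : 1 ≤ m)
    (A : Fin r → Matrix (Fin m) (Fin m) (L1Space a b))
    (B : (Fin m → CSpace a b (r - 1)) →L[ℂ] (Fin (r * m) → ℂ))
    (hAB : UniquelySolvable A B)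
    (X : Set (Matrix (Fin m) (Fin m) (L1Space a b))) (hX : Dense X) :
    -- a sequence of multipoint problems, chosen before `f` and `q`
    (∃ (Ak : ℕ → Fin r → Matrix (Fin m) (Fin m) (L1Space a b)) (M : ℕ → MultipointData a b r m),
      (∀ k l, Ak k l ∈ X) ∧ Approximates Ak (fun k => (M k).op) A B) ∧
    -- the sequence is explicit: any approximations `Ak k l ∈ X` of the coefficients will do (and
    -- they exist), together with the explicit multipoint operators built from `B`
    (∃ Ak : ℕ → Fin r → Matrix (Fin m) (Fin m) (L1Space a b),
      (∀ k l, Ak k l ∈ X) ∧ ∀ l, Tendsto (fun k => Ak k l) atTop (𝓝 (A l))) ∧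
    (∀ Ak : ℕ → Fin r → Matrix (Fin m) (Fin m) (L1Space a b),
      (∀ k l, Ak k l ∈ X) → (∀ l, Tendsto (fun k => Ak k l) atTop (𝓝 (A l))) →
      Approximates Ak (fun k => (explicitMultipoint B k).op) A B) := by
  have hex : ∃ Ak : ℕ → Fin r → Matrix (Fin m) (Fin m) (L1Space a b),
      (∀ k l, Ak k l ∈ X) ∧ ∀ l, Tendsto (fun k => Ak k l) atTop (𝓝 (A l)) := by
    -- First countability turns density of `X` into approximating sequences.
    have : FirstCountableTopology (Matrix (Fin m) (Fin m) (L1Space a b)) :=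
      inferInstanceAs (FirstCountableTopology (Fin m → Fin m → L1Space a b))
    choose u hu using fun l => mem_closure_iff_seq_limit.1 (hX (A l))
    exact ⟨fun k l => u l k, fun k l => (hu l).1 k, fun l => (hu l).2⟩
  have hall : ∀ Ak : ℕ → Fin r → Matrix (Fin m) (Fin m) (L1Space a b),
      (∀ k l, Ak k l ∈ X) → (∀ l, Tendsto (fun k => Ak k l) atTop (𝓝 (A l))) →
      Approximates Ak (fun k => (explicitMultipoint B k).op) A B := by
    intro Ak _ hA
    have h := approximates_of_tendsto hr (Bk := fun k => (explicitMultipoint B k).opL) hAB hA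
      (fun y => by
        simp only [MultipointData.coe_opL]
        exact tendsto_explicitMultipoint_op hr B y)
    simpa only [MultipointData.coe_opL] using h
  obtain ⟨Ak, hAk, hlim⟩ := hex
  exact ⟨⟨Ak, explicitMultipoint B, hAk, hall Ak hAk hlim⟩, ⟨Ak, hAk, hlim⟩, hall⟩
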